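/- Let $n=1$, $F(p)=\tfrac12 p^2$ for $p\in\mathbb R$, and $g(x)=-|x|$ for $x\in\mathbb R$. For $\varepsilon>0$ let $u^\varepsilon\in C(\mathbb R\times[0,\infty))$ be the viscosity solution of $$u^\varepsilon_t+\tfrac12|u^\varepsilon_x|^2=\varepsilon u^\varepsilon_{xx}\ \text{ in } \mathbb R\times(0,\infty),\qquad u^\varepsilon(x,0)=-|x|\ \text{ on }\mathbb R,$$ and let $u\in C(\mathbb R\times[0,\infty))$ be the viscosity solution of $$u_t+\tfrac12|u_x|^2=0\ \text{ in } \mathbb R\times(0,\infty),\qquad u(x,0)=-|x|\ \text{ on }\mathbb R.$$ Then there is an absolute constant $C>0$ such that for all $\varepsilon\in(0,1)$ and all $T>0$ $$\|u^\varepsilon-u\|_{L^\infty(\mathbb R\times[0,T])}\le C\sqrt{T\varepsilon},$$ and this upper bound is sharp in the sense that, for every $\varepsilon>0$, $$\lim_{t\to0^+}\frac{u^\varepsilon(0,t)-u(0,t)}{\sqrt{t\varepsilon}}=-\frac{2}{\sqrt\pi}.$$ -/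

import Mathlib

open Set Filter Topology MeasureTheory

/-- `u` is a viscosity subsolution of `u_t + F(u_x) = ε u_xx` in `ℝ × (0,∞)`: at every point with
positive time where `u - φ` has a local maximum, for a test function `φ` that is `C²` near that
point, `φ_t + F(φ_x) ≤ ε φ_xx`. Points of space-time are pairs `(x, t)`. -/
def IsViscositySubsolution (F : ℝ → ℝ) (ε : ℝ) (u : ℝ × ℝ → ℝ) : Prop :=
  ∀ (φ : ℝ × ℝ → ℝ) (x t : ℝ), 0 < t → ContDiffAt ℝ 2 φ (x, t) →
    IsLocalMax (fun z => u z - φ z) (x, t) →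
      deriv (fun s => φ (x, s)) t + F (deriv (fun y => φ (y, t)) x)
        ≤ ε * iteratedDeriv 2 (fun y => φ (y, t)) x

/-- `u` is a viscosity supersolution of `u_t + F(u_x) = ε u_xx` in `ℝ × (0,∞)`: at every point
with positive time where `u - φ` has a local minimum, for a test function `φ` that is `C²` near
that point, `φ_t + F(φ_x) ≥ ε φ_xx`. -/
def IsViscositySupersolution (F : ℝ → ℝ) (ε : ℝ) (u : ℝ × ℝ → ℝ) : Prop :=
  ∀ (φ : ℝ × ℝ → ℝ) (x t : ℝ), 0 < t → ContDiffAt ℝ 2 φ (x, t) →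
    IsLocalMin (fun z => u z - φ z) (x, t) →
      ε * iteratedDeriv 2 (fun y => φ (y, t)) x
        ≤ deriv (fun s => φ (x, s)) t + F (deriv (fun y => φ (y, t)) x)

/-- `u ∈ C(ℝ × [0,∞))` is a viscosity solution of the Cauchy problem
`u_t + F(u_x) = ε u_xx` in `ℝ × (0,∞)`, `u(x,0) = g(x)` on `ℝ`.
For `ε = 0` this is the first-order problem `u_t + F(u_x) = 0`.
The values of `u` at negative times play no role. -/
structure IsViscositySolution (F : ℝ → ℝ) (ε : ℝ) (g : ℝ → ℝ) (u : ℝ × ℝ → ℝ) : Prop where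
  continuousOn : ContinuousOn u (univ ×ˢ Ici 0)
  subsolution : IsViscositySubsolution F ε u
  supersolution : IsViscositySupersolution F ε u
  initial : ∀ x : ℝ, u (x, 0) = g x

/-! The Hopf–Cole transform w = exp(-u^ε/(2ε)) turns the viscous problem into the heat equation w_t
= ε w_xx with initial value exp(|x|/(2ε)), whose solution is explicit. With y = |x|/(2√(εt)), q =
√t/(2√ε) and N the distribution function of the density e^{-s²}/√π, it equals exp((|x|/2 + t/4)/ε) ·
(N(y+q) + e^{-4yq} N(q-y)). The exponential is the transform of the inviscid solution -|x| - t/2,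
and the second factor lies between 1 and 1 + 2q/√π, so 0 ≤ u - u^ε ≤ 2ε · 2q/√π = (2/√π) √(tε). At x
= 0 the factor is 2N(q), and the slope 2/√π of log(2N) at q = 0 is the sharp limit.

The substance is that the viscosity solutions are only continuous, with no growth condition, so each
must be identified with its formula.

In the viscous case positivity of w replaces growth, as in Widder's theorem. Comparison on large
boxes gives w at least the explicit solution. For the converse, w on the line x = R generates a
caloric function which, by comparison, is bounded at the origin at a later time by a multiple of w
there. Gaussian decay then makes its value at a fixed earlier point negligible as R grows, so it
serves as a lateral barrier (`IsHeatSupersolution.exists_lateral_barrier`).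

In the inviscid case upper bounds come from local barriers and from planes. For the lower bound, a
Hopf–Lax barrier shows that one value of u at a later time forces u ≥ -B - αx²
(`IsViscositySolution.sub_le_of_lt`), and a quartic correction to the explicit solution then beats
this growth at the sides. -/

/-! ### Classical and viscosity solutions of the heat equation -/

/-- `ψ` is `C²` near `(x, t)` and solves `ψ_t = ε ψ_xx` at that point. -/
def HeatAt (ε : ℝ) (ψ : ℝ × ℝ → ℝ) (x t : ℝ) : Prop :=
  ContDiffAt ℝ 2 ψ (x, t) ∧
    deriv (fun s => ψ (x, s)) t = ε * iteratedDeriv 2 (fun y => ψ (y, t)) x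

/-- Viscosity supersolutions of the heat equation `w_t = ε w_xx` in `ℝ × (0,∞)`. -/
def IsHeatSupersolution (ε : ℝ) (w : ℝ × ℝ → ℝ) : Prop :=
  ∀ (ψ : ℝ × ℝ → ℝ) (x t : ℝ), 0 < t → ContDiffAt ℝ 2 ψ (x, t) →
    IsLocalMin (fun z => w z - ψ z) (x, t) →
      ε * iteratedDeriv 2 (fun y => ψ (y, t)) x ≤ deriv (fun s => ψ (x, s)) t

theorem iteratedDeriv_two_eq_of_hasDerivAt {f g : ℝ → ℝ} {x X : ℝ}
    (h : ∀ᶠ y in 𝓝 x, HasDerivAt f (g y) y) (hg : HasDerivAt g X x) :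
    iteratedDeriv 2 f x = X := by
  rw [iteratedDeriv_succ, iteratedDeriv_one]
  have : deriv f =ᶠ[𝓝 x] g := h.mono fun y hy => hy.deriv
  rw [this.deriv_eq, hg.deriv]

theorem contDiffAt_slice_left {ψ : ℝ × ℝ → ℝ} {x t : ℝ} (h : ContDiffAt ℝ 2 ψ (x, t)) :
    ContDiffAt ℝ 2 (fun y => ψ (y, t)) x :=
  ContDiffAt.comp (f := fun y : ℝ => (y, t)) x h (contDiffAt_id.prodMk contDiffAt_const)

theorem contDiffAt_slice_right {ψ : ℝ × ℝ → ℝ} {x t : ℝ} (h : ContDiffAt ℝ 2 ψ (x, t)) :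
    ContDiffAt ℝ 2 (fun s => ψ (x, s)) t :=
  ContDiffAt.comp (f := fun s : ℝ => (x, s)) t h (contDiffAt_const.prodMk contDiffAt_id)

theorem differentiableAt_slice_right {ψ : ℝ × ℝ → ℝ} {x t : ℝ} (h : ContDiffAt ℝ 2 ψ (x, t)) :
    DifferentiableAt ℝ (fun s => ψ (x, s)) t :=
  (contDiffAt_slice_right h).differentiableAt (by norm_num)

theorem HeatAt.add {ε : ℝ} {ψ₁ ψ₂ : ℝ × ℝ → ℝ} {x t : ℝ} (h₁ : HeatAt ε ψ₁ x t)
    (h₂ : HeatAt ε ψ₂ x t) : HeatAt ε (fun z => ψ₁ z + ψ₂ z) x t := by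
  refine ⟨h₁.1.add h₂.1, ?_⟩
  have e := iteratedDeriv_fun_add (contDiffAt_slice_left h₁.1) (contDiffAt_slice_left h₂.1)
  rw [e, deriv_fun_add (differentiableAt_slice_right h₁.1) (differentiableAt_slice_right h₂.1),
    h₁.2, h₂.2]
  ring

theorem HeatAt.const_mul {ε : ℝ} {ψ : ℝ × ℝ → ℝ} {x t : ℝ} (h : HeatAt ε ψ x t) (c : ℝ) :
    HeatAt ε (fun z => c * ψ z) x t := by
  refine ⟨contDiffAt_const.mul h.1, ?_⟩
  simp only
  rw [iteratedDeriv_const_mul c (contDiffAt_slice_left h.1),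
    deriv_const_mul _ (differentiableAt_slice_right h.1), h.2]
  ring

theorem HeatAt.const (ε c x t : ℝ) : HeatAt ε (fun _ => c) x t := by
  refine ⟨contDiffAt_const, ?_⟩
  simp [iteratedDeriv_const]

theorem HeatAt.neg {ε : ℝ} {ψ : ℝ × ℝ → ℝ} {x t : ℝ} (h : HeatAt ε ψ x t) :
    HeatAt ε (fun z => -ψ z) x t := by
  simpa using h.const_mul (-1)

theorem HeatAt.sub {ε : ℝ} {ψ₁ ψ₂ : ℝ × ℝ → ℝ} {x t : ℝ} (h₁ : HeatAt ε ψ₁ x t)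
    (h₂ : HeatAt ε ψ₂ x t) : HeatAt ε (fun z => ψ₁ z - ψ₂ z) x t := by
  simpa [sub_eq_add_neg] using h₁.add h₂.neg

theorem HeatAt.sum {ι : Type*} {ε : ℝ} {x t : ℝ} (s : Finset ι) {ψ : ι → ℝ × ℝ → ℝ}
    (h : ∀ i ∈ s, HeatAt ε (ψ i) x t) : HeatAt ε (fun z => ∑ i ∈ s, ψ i z) x t := by
  classical
  induction s using Finset.induction_on with
  | empty => simpa using HeatAt.const ε 0 x t
  | insert a s ha ih =>
    simp only [Finset.sum_insert ha]
    exact (h a (by simp)).add (ih fun i hi => h i (by simp [hi]))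

theorem HeatAt.of_hasDerivAt {ε : ℝ} {ψ : ℝ × ℝ → ℝ} {x t τ X : ℝ} {g : ℝ → ℝ}
    (hc : ContDiffAt ℝ 2 ψ (x, t)) (ht : HasDerivAt (fun s => ψ (x, s)) τ t)
    (hx : ∀ᶠ y in 𝓝 x, HasDerivAt (fun y => ψ (y, t)) (g y) y) (hxx : HasDerivAt g X x)
    (he : τ = ε * X) : HeatAt ε ψ x t := by
  refine ⟨hc, ?_⟩
  rw [iteratedDeriv_two_eq_of_hasDerivAt hx hxx, ht.deriv, he]

/-! ### Comparison on boxes -/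

/-- If `v ≥ ψ` on the parabolic boundary of a box but not inside, then a small perturbation of
`ψ` touches `v` from below inside the box. -/
theorem exists_isLocalMin_of_lt {v ψ : ℝ × ℝ → ℝ} {a b t₀ t₁ : ℝ}
    (hc : ContinuousOn (fun z => v z - ψ z) (Icc a b ×ˢ Icc t₀ t₁))
    (hbot : ∀ x ∈ Icc a b, ψ (x, t₀) ≤ v (x, t₀))
    (hl : ∀ t ∈ Icc t₀ t₁, ψ (a, t) ≤ v (a, t))
    (hr : ∀ t ∈ Icc t₀ t₁, ψ (b, t) ≤ v (b, t))
    {x t : ℝ} (hx : x ∈ Icc a b) (ht : t ∈ Ico t₀ t₁) (hlt : v (x, t) < ψ (x, t)) :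
    ∃ κ > 0, ∃ y ∈ Ioo a b, ∃ s ∈ Ioo t₀ t₁,
      IsLocalMin (fun z : ℝ × ℝ => v z - (ψ z - κ / (t₁ - z.2))) (y, s) := by
  obtain ⟨ht0, ht1⟩ := ht
  set d := ψ (x, t) - v (x, t) with hd
  have hdpos : 0 < d := by linarith
  have htt : 0 < t₁ - t := by linarith
  -- With this κ the penalty at `(x, t)` is d/2, half the gap, so the minimum stays negative. The
  -- penalty blows up at t₁, and at time t₁ - m it already exceeds the bound D, so the minimum is
  -- not attained there.
  set κ := d * (t₁ - t) / 2 with hκ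
  have hκpos : 0 < κ := by positivity
  obtain ⟨D, hD⟩ := (isCompact_Icc.prod isCompact_Icc).exists_bound_of_continuousOn hc
  have hD0 : 0 ≤ D := (norm_nonneg _).trans (hD (x, t) ⟨hx, ht0, ht1.le⟩)
  set m := min ((t₁ - t) / 2) (κ / (D + 1)) with hm
  have hmpos : 0 < m := lt_min (by linarith) (by positivity)
  have hm1 : m ≤ (t₁ - t) / 2 := min_le_left _ _
  have hm2 : m ≤ κ / (D + 1) := min_le_right _ _
  set g : ℝ × ℝ → ℝ := fun z => v z - (ψ z - κ / (t₁ - z.2)) with hg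
  have hsub : Icc a b ×ˢ Icc t₀ (t₁ - m) ⊆ Icc a b ×ˢ Icc t₀ t₁ :=
    prod_mono le_rfl (Icc_subset_Icc le_rfl (by linarith))
  have hgc : ContinuousOn g (Icc a b ×ˢ Icc t₀ (t₁ - m)) := by
    have h1 : ContinuousOn (fun z : ℝ × ℝ => κ / (t₁ - z.2)) (Icc a b ×ˢ Icc t₀ (t₁ - m)) := by
      refine continuousOn_const.div (by fun_prop) ?_
      rintro z ⟨-, -, hz⟩
      have : 0 < t₁ - z.2 := by linarith
      exact this.ne'
    refine ((hc.mono hsub).add h1).congr fun z _ => ?_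
    simp only [hg, Pi.add_apply]; ring
  have hmem : (x, t) ∈ Icc a b ×ˢ Icc t₀ (t₁ - m) := ⟨hx, ht0, by simp only; linarith⟩
  obtain ⟨⟨y, s⟩, ⟨hy, hs⟩, hmin⟩ := (isCompact_Icc.prod isCompact_Icc).exists_isMinOn
    ⟨_, hmem⟩ hgc
  simp only at hy hs
  have hneg : g (y, s) < 0 := by
    refine lt_of_le_of_lt (hmin hmem) ?_
    have : κ / (t₁ - t) = d / 2 := by rw [hκ]; field_simp
    simp only [hg, this]
    linarith
  have hst : s < t₁ := by linarith [hs.2]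
  have hpos : 0 < κ / (t₁ - s) := div_pos hκpos (by linarith)
  simp only [hg] at hneg
  have hya : y ≠ a := by
    rintro rfl
    linarith [hl s ⟨hs.1, hst.le⟩]
  have hyb : y ≠ b := by
    rintro rfl
    linarith [hr s ⟨hs.1, hst.le⟩]
  have hs0 : s ≠ t₀ := by
    rintro rfl
    linarith [hbot y hy]
  have hs1 : s ≠ t₁ - m := by
    intro h
    have h1 := hD (y, s) ⟨hy, hs.1, hst.le⟩
    rw [Real.norm_eq_abs] at h1
    have h2 := (abs_le.1 h1).1
    have h3 : t₁ - s = m := by linarith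
    have h4 : D + 1 ≤ κ / (t₁ - s) := by
      rw [h3, le_div_iff₀ hmpos, mul_comm]
      rwa [le_div_iff₀ (by linarith)] at hm2
    linarith
  have hy' : y ∈ Ioo a b := ⟨lt_of_le_of_ne hy.1 hya.symm, lt_of_le_of_ne hy.2 hyb⟩
  have hs' : s ∈ Ioo t₀ (t₁ - m) := ⟨lt_of_le_of_ne hs.1 hs0.symm, lt_of_le_of_ne hs.2 hs1⟩
  refine ⟨κ, hκpos, y, hy', s, ⟨hs'.1, by linarith [hs'.2]⟩, hmin.isLocalMin ?_⟩
  exact prod_mem_nhds (Icc_mem_nhds hy'.1 hy'.2) (Icc_mem_nhds hs'.1 hs'.2)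

theorem hasDerivAt_const_div_sub {κ t₁ s : ℝ} (h : s < t₁) :
    HasDerivAt (fun r => κ / (t₁ - r)) (κ / (t₁ - s) ^ 2) s := by
  have h1 : t₁ - s ≠ 0 := by linarith
  have := (((hasDerivAt_id s).const_sub t₁).inv h1).const_mul κ
  refine (this.congr_deriv ?_ :)
  simp [div_eq_mul_inv]

theorem contDiffAt_sub_const_div {ψ : ℝ × ℝ → ℝ} {κ t₁ x t : ℝ} (h : ContDiffAt ℝ 2 ψ (x, t))
    (ht : t < t₁) : ContDiffAt ℝ 2 (fun z : ℝ × ℝ => ψ z - κ / (t₁ - z.2)) (x, t) := by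
  refine h.sub (contDiffAt_const.div (contDiffAt_const.sub contDiffAt_snd) ?_)
  exact (sub_pos.2 ht).ne'

theorem deriv_sub_const_div {ψ : ℝ × ℝ → ℝ} {κ t₁ x t : ℝ} (h : ContDiffAt ℝ 2 ψ (x, t))
    (ht : t < t₁) : deriv (fun s => ψ (x, s) - κ / (t₁ - s)) t
      = deriv (fun s => ψ (x, s)) t - κ / (t₁ - t) ^ 2 :=
  ((differentiableAt_slice_right h).hasDerivAt.sub (hasDerivAt_const_div_sub ht)).deriv

/-- At the touching point the penalty contributes -κ/(t₁ - s)² to the time derivative, so the test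
inequality contradicts the heat equation for ψ. -/
theorem IsHeatSupersolution.comparison {ε : ℝ} {w ψ : ℝ × ℝ → ℝ} {a b t₀ t₁ : ℝ}
    (hw : IsHeatSupersolution ε w) (h0 : 0 ≤ t₀)
    (hwc : ContinuousOn w (univ ×ˢ Ici 0))
    (hψc : ContinuousOn ψ (Icc a b ×ˢ Icc t₀ t₁))
    (hψ : ∀ x ∈ Ioo a b, ∀ t ∈ Ioo t₀ t₁, HeatAt ε ψ x t)
    (hbot : ∀ x ∈ Icc a b, ψ (x, t₀) ≤ w (x, t₀))
    (hl : ∀ t ∈ Icc t₀ t₁, ψ (a, t) ≤ w (a, t))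
    (hr : ∀ t ∈ Icc t₀ t₁, ψ (b, t) ≤ w (b, t))
    {x t : ℝ} (hx : x ∈ Icc a b) (ht : t ∈ Ico t₀ t₁) : ψ (x, t) ≤ w (x, t) := by
  by_contra! hlt
  have hc : ContinuousOn (fun z => w z - ψ z) (Icc a b ×ˢ Icc t₀ t₁) :=
    (hwc.mono (prod_mono (subset_univ _) fun s hs => h0.trans hs.1)).sub hψc
  obtain ⟨κ, hκ, y, hy, s, hs, hmin⟩ := exists_isLocalMin_of_lt hc hbot hl hr hx ht hlt
  have hh := hψ y hy s hs
  have := hw _ y s (h0.trans_lt hs.1) (contDiffAt_sub_const_div hh.1 hs.2) hmin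
  simp only at this
  rw [deriv_sub_const_div hh.1 hs.2, hh.2] at this
  have e : iteratedDeriv 2 (fun y => ψ (y, s) - κ / (t₁ - s)) y
      = iteratedDeriv 2 (fun y => ψ (y, s)) y := by
    have e := iteratedDeriv_fun_sub (contDiffAt_slice_left hh.1)
      (contDiffAt_const (c := κ / (t₁ - s)))
    rw [e]
    simp [iteratedDeriv_const]
  rw [e] at this
  have h2 : 0 < κ / (t₁ - s) ^ 2 := div_pos hκ (pow_pos (by linarith [hs.2]) 2)
  linarith

/-! ### The Hopf–Cole transform of viscosity inequalities -/

theorem iteratedDeriv_two_const_mul_log {h : ℝ → ℝ} {x k : ℝ} (hh : ContDiffAt ℝ 2 h x)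
    (h0 : 0 < h x) : iteratedDeriv 2 (fun y => k * Real.log (h y)) x
      = k * (iteratedDeriv 2 h x / h x - (deriv h x) ^ 2 / (h x) ^ 2) := by
  have hd : ∀ᶠ y in 𝓝 x, ContDiffAt ℝ 2 h y ∧ 0 < h y :=
    (hh.eventually (by simp)).and (hh.continuousAt.eventually (lt_mem_nhds h0))
  have h1 : HasDerivAt (deriv h) (iteratedDeriv 2 h x) x := by
    rw [iteratedDeriv_succ, iteratedDeriv_one]
    refine DifferentiableAt.hasDerivAt ?_
    have := (hh.fderiv_right (m := 1) (by norm_num)).clm_apply (contDiffAt_const (c := (1 : ℝ)))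
    exact this.differentiableAt (by norm_num)
  refine iteratedDeriv_two_eq_of_hasDerivAt (g := fun y => k * (deriv h y / h y)) ?_ ?_
  · filter_upwards [hd] with y hy
    exact ((hy.1.differentiableAt (by norm_num)).hasDerivAt.log hy.2.ne').const_mul k
  · have := (h1.div (hh.differentiableAt (by norm_num)).hasDerivAt h0.ne').const_mul k
    refine (this.congr_deriv ?_ :)
    have := h0.ne'
    field_simp

theorem hopfCole_pde_iff {ε a p X c : ℝ} (hε : 0 < ε) (hc : 0 < c) :
    (-2 * ε) * (a / c) + ((-2 * ε) * (p / c)) ^ 2 / 2 - ε * ((-2 * ε) * (X / c - p ^ 2 / c ^ 2))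
      = (2 * ε / c) * (ε * X - a) := by
  field_simp
  ring

theorem hopfCole_derivs {ε : ℝ} {ψ : ℝ × ℝ → ℝ} {x t : ℝ} (hε : 0 < ε)
    (h : ContDiffAt ℝ 2 ψ (x, t)) (hpos : 0 < ψ (x, t)) :
    deriv (fun s => (-2 * ε) * Real.log (ψ (x, s))) t
      + (deriv (fun y => (-2 * ε) * Real.log (ψ (y, t))) x) ^ 2 / 2
      - ε * iteratedDeriv 2 (fun y => (-2 * ε) * Real.log (ψ (y, t))) x
      = (2 * ε / ψ (x, t)) * (ε * iteratedDeriv 2 (fun y => ψ (y, t)) x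
          - deriv (fun s => ψ (x, s)) t) := by
  have h1 := ((differentiableAt_slice_right h).hasDerivAt.log hpos.ne').const_mul (-2 * ε)
  have h2 := (((contDiffAt_slice_left h).differentiableAt (by norm_num)).hasDerivAt.log
    hpos.ne').const_mul (-2 * ε)
  rw [h1.deriv, h2.deriv, iteratedDeriv_two_const_mul_log (contDiffAt_slice_left h) hpos,
    hopfCole_pde_iff hε hpos]

theorem le_neg_two_mul_log_iff {ε a b : ℝ} (hε : 0 < ε) (hb : 0 < b) :
    a ≤ -2 * ε * Real.log b ↔ b ≤ Real.exp (-a / (2 * ε)) := by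
  rw [← Real.log_le_iff_le_exp hb, le_div_iff₀ (by positivity)]
  constructor <;> intro h <;> linarith

theorem neg_two_mul_log_le_iff {ε a b : ℝ} (hε : 0 < ε) (hb : 0 < b) :
    -2 * ε * Real.log b ≤ a ↔ Real.exp (-a / (2 * ε)) ≤ b := by
  rw [← Real.le_log_iff_exp_le hb, div_le_iff₀ (by positivity)]
  constructor <;> intro h <;> linarith

/-- The transform is decreasing, so it exchanges sub- and supersolutions: a test function below w,
raised by c to touch it, pulls back through -2ε log to one touching u from above. -/
theorem IsViscositySubsolution.hopfCole {ε : ℝ} {u : ℝ × ℝ → ℝ} (hε : 0 < ε)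
    (hu : IsViscositySubsolution (fun p => p ^ 2 / 2) ε u) :
    IsHeatSupersolution ε (fun z => Real.exp (-u z / (2 * ε))) := by
  intro ψ x t ht hψ hmin
  set c := Real.exp (-u (x, t) / (2 * ε)) - ψ (x, t) with hc
  have hψ' : ContDiffAt ℝ 2 (fun z => ψ z + c) (x, t) := hψ.add contDiffAt_const
  have hval : ψ (x, t) + c = Real.exp (-u (x, t) / (2 * ε)) := by rw [hc]; ring
  have hpos : 0 < ψ (x, t) + c := hval ▸ Real.exp_pos _
  have hmax : IsLocalMax (fun z => u z - (-2 * ε) * Real.log (ψ z + c)) (x, t) := by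
    have hev : ∀ᶠ z in 𝓝 (x, t), 0 < ψ z + c := hψ'.continuousAt.eventually (lt_mem_nhds hpos)
    filter_upwards [hev, hmin] with z hz hz'
    have e1 : -2 * ε * Real.log (ψ (x, t) + c) = u (x, t) := by
      rw [hval, Real.log_exp]; field_simp
    have e2 : u z ≤ -2 * ε * Real.log (ψ z + c) := by
      rw [le_neg_two_mul_log_iff hε hz]; linarith
    linarith
  have h1 := hu _ x t ht (contDiffAt_const.mul (hψ'.log hpos.ne')) hmax
  have h2 := hopfCole_derivs hε hψ' hpos
  have e1 : iteratedDeriv 2 (fun y => ψ (y, t) + c) x = iteratedDeriv 2 (fun y => ψ (y, t)) x := by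
    have e := iteratedDeriv_fun_add (contDiffAt_slice_left hψ) (contDiffAt_const (c := c))
    rw [e]
    simp [iteratedDeriv_const]
  rw [e1, deriv_add_const] at h2
  simp only at h1
  have h3 : 2 * ε / (ψ (x, t) + c) * (ε * iteratedDeriv 2 (fun y => ψ (y, t)) x -
      deriv (fun s => ψ (x, s)) t) ≤ 0 := by linarith
  have h4 : 0 < 2 * ε / (ψ (x, t) + c) := by positivity
  linarith [nonpos_of_mul_nonpos_right h3 h4]

/-- Here w is a subsolution of the heat equation. By linearity this is expressed as -w being a
supersolution, so a single comparison theorem serves both cases. -/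
theorem IsViscositySupersolution.hopfCole {ε : ℝ} {u : ℝ × ℝ → ℝ} (hε : 0 < ε)
    (hu : IsViscositySupersolution (fun p => p ^ 2 / 2) ε u) :
    IsHeatSupersolution ε (fun z => -Real.exp (-u z / (2 * ε))) := by
  intro ψ' x t ht hψ' hmin
  obtain ⟨ψ, rfl⟩ : ∃ ψ : ℝ × ℝ → ℝ, ψ' = fun z => -ψ z := ⟨fun z => -ψ' z, by simp⟩
  have hψ : ContDiffAt ℝ 2 ψ (x, t) := by simpa using hψ'.neg
  set c := Real.exp (-u (x, t) / (2 * ε)) - ψ (x, t) with hc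
  have hψ' : ContDiffAt ℝ 2 (fun z => ψ z + c) (x, t) := hψ.add contDiffAt_const
  have hval : ψ (x, t) + c = Real.exp (-u (x, t) / (2 * ε)) := by rw [hc]; ring
  have hpos : 0 < ψ (x, t) + c := hval ▸ Real.exp_pos _
  have hmin' : IsLocalMin (fun z => u z - (-2 * ε) * Real.log (ψ z + c)) (x, t) := by
    have hev : ∀ᶠ z in 𝓝 (x, t), 0 < ψ z + c := hψ'.continuousAt.eventually (lt_mem_nhds hpos)
    filter_upwards [hev, hmin] with z hz hz'
    have e1 : -2 * ε * Real.log (ψ (x, t) + c) = u (x, t) := by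
      rw [hval, Real.log_exp]; field_simp
    have e2 : -2 * ε * Real.log (ψ z + c) ≤ u z := by
      rw [neg_two_mul_log_le_iff hε hz]; linarith
    linarith
  have h1 := hu _ x t ht (contDiffAt_const.mul (hψ'.log hpos.ne')) hmin'
  have h2 := hopfCole_derivs hε hψ' hpos
  have e1 : iteratedDeriv 2 (fun y => ψ (y, t) + c) x = iteratedDeriv 2 (fun y => ψ (y, t)) x := by
    have e := iteratedDeriv_fun_add (contDiffAt_slice_left hψ) (contDiffAt_const (c := c))
    rw [e]
    simp [iteratedDeriv_const]
  rw [e1, deriv_add_const] at h2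
  simp only at h1
  have h3 : 0 ≤ 2 * ε / (ψ (x, t) + c) * (ε * iteratedDeriv 2 (fun y => ψ (y, t)) x -
      deriv (fun s => ψ (x, s)) t) := by linarith
  have h4 : 0 < 2 * ε / (ψ (x, t) + c) := by positivity
  have h5 := nonneg_of_mul_nonneg_right h3 h4
  have e2 : iteratedDeriv 2 (fun y => -ψ (y, t)) x = - iteratedDeriv 2 (fun y => ψ (y, t)) x :=
    iteratedDeriv_fun_neg 2 _ x
  simp only
  rw [e2, deriv.fun_neg]
  linarith

/-! ### The lateral heat kernel -/

/-- The function `y ^ (-3/2) * exp (-1/y)`, extended by `0` to `y ≤ 0`. -/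
noncomputable def flatProfile (y : ℝ) : ℝ :=
  y ^ (3 / 2 : ℝ) * (y⁻¹ ^ 3 * expNegInvGlue y)

/-- A primitive of `flatProfile`. -/
noncomputable def lateralProfile (y : ℝ) : ℝ := ∫ v in (0 : ℝ)..y, flatProfile v

theorem flatProfile_of_nonpos {y : ℝ} (hy : y ≤ 0) : flatProfile y = 0 := by
  simp [flatProfile, expNegInvGlue.zero_of_nonpos hy]

theorem flatProfile_nonneg (y : ℝ) : 0 ≤ flatProfile y := by
  rcases le_or_gt y 0 with h | h
  · rw [flatProfile_of_nonpos h]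
  · have := expNegInvGlue.nonneg y
    unfold flatProfile; positivity

theorem flatProfile_of_pos {y : ℝ} (hy : 0 < y) :
    flatProfile y = y ^ (-(3 / 2) : ℝ) * Real.exp (-y⁻¹) := by
  have h1 : expNegInvGlue y = Real.exp (-y⁻¹) := by simp [expNegInvGlue, hy.not_ge]
  have h2 : (y⁻¹ ^ 3 : ℝ) = y ^ (-3 : ℝ) := by
    rw [Real.rpow_neg hy.le, inv_pow]; norm_cast
  rw [flatProfile, h1, h2, ← mul_assoc, ← Real.rpow_add hy]
  norm_num

/-- The factorization y^{3/2} · (y⁻³ e^{-1/y}) is chosen for this: the first factor is C¹ and the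
second is smooth across 0. Hence the primitive is C² and the kernel built from it stays C² across
its starting time. -/
theorem contDiff_flatProfile : ContDiff ℝ 1 flatProfile := by
  refine (Real.contDiff_rpow_const_of_le (by norm_num)).mul ?_
  have := expNegInvGlue.contDiff_polynomial_eval_inv_mul (n := 1) (Polynomial.X ^ 3)
  simpa using this

theorem hasDerivAt_lateralProfile (y : ℝ) : HasDerivAt lateralProfile (flatProfile y) y :=
  intervalIntegral.integral_hasDerivAt_right
    (contDiff_flatProfile.continuous.intervalIntegrable _ _)
    (contDiff_flatProfile.continuous.stronglyMeasurableAtFilter _ _)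
    contDiff_flatProfile.continuous.continuousAt

theorem contDiff_lateralProfile : ContDiff ℝ 2 lateralProfile := by
  have h : (2 : WithTop ℕ∞) = 1 + 1 := by norm_num
  rw [h, contDiff_succ_iff_deriv]
  refine ⟨fun y => (hasDerivAt_lateralProfile y).differentiableAt, by simp, ?_⟩
  have : deriv lateralProfile = flatProfile := funext fun y => (hasDerivAt_lateralProfile y).deriv
  rw [this]
  exact contDiff_flatProfile

theorem monotone_lateralProfile : Monotone lateralProfile :=
  monotone_of_hasDerivAt_nonneg hasDerivAt_lateralProfile flatProfile_nonneg

theorem lateralProfile_of_nonpos {y : ℝ} (hy : y ≤ 0) : lateralProfile y = 0 := by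
  have : lateralProfile y = ∫ v in (0 : ℝ)..y, (0 : ℝ) := by
    refine intervalIntegral.integral_congr fun v hv => ?_
    rw [uIcc_of_ge hy] at hv
    exact flatProfile_of_nonpos hv.2
  simpa using this

theorem lateralProfile_nonneg (y : ℝ) : 0 ≤ lateralProfile y := by
  rcases le_or_gt y 0 with h | h
  · rw [lateralProfile_of_nonpos h]
  · simpa [lateralProfile_of_nonpos le_rfl] using monotone_lateralProfile h.le

theorem flatProfile_pos {y : ℝ} (hy : 0 < y) : 0 < flatProfile y := by
  rw [flatProfile_of_pos hy]; positivity

theorem lateralProfile_pos {y : ℝ} (hy : 0 < y) : 0 < lateralProfile y :=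
  intervalIntegral.intervalIntegral_pos_of_pos_on
    (contDiff_flatProfile.continuous.intervalIntegrable _ _) (fun _ hx => flatProfile_pos hx.1) hy

/-- Half of the exponent absorbs the power of y. -/
theorem flatProfile_le {y : ℝ} (hy : 0 < y) : flatProfile y ≤ 8 * Real.exp (-(2 * y)⁻¹) := by
  rw [flatProfile_of_pos hy]
  set v := y⁻¹ with hv
  have hvp : 0 < v := by positivity
  have h1 : y ^ (-(3 / 2) : ℝ) = v ^ (3 / 2 : ℝ) := by
    rw [hv, Real.inv_rpow hy.le, Real.rpow_neg hy.le]
  have h2 : v ^ (3 / 2 : ℝ) ≤ 1 + v ^ 2 := by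
    rcases le_total v 1 with h | h
    · have := Real.rpow_le_one hvp.le h (by norm_num : (0 : ℝ) ≤ 3 / 2)
      nlinarith
    · have := Real.rpow_le_rpow_of_exponent_le h (by norm_num : (3 / 2 : ℝ) ≤ (2 : ℕ))
      rw [Real.rpow_natCast] at this
      linarith
  have h3 : 1 + v ^ 2 ≤ 8 * Real.exp (v / 2) := by
    have := Real.quadratic_le_exp_of_nonneg (x := v / 2) (by positivity)
    nlinarith
  have h4 : (2 * y)⁻¹ = v / 2 := by rw [hv]; field_simp
  have h5 : Real.exp (-v) = Real.exp (-(v / 2)) * Real.exp (-(v / 2)) := by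
    rw [← Real.exp_add]; ring_nf
  have h6 : Real.exp (v / 2) * Real.exp (-(v / 2)) = 1 := by
    rw [← Real.exp_add]; simp
  rw [h1, h4, h5]
  calc v ^ (3 / 2 : ℝ) * (Real.exp (-(v / 2)) * Real.exp (-(v / 2)))
      ≤ (8 * Real.exp (v / 2)) * (Real.exp (-(v / 2)) * Real.exp (-(v / 2))) := by
        gcongr; exact h2.trans h3
    _ = 8 * (Real.exp (v / 2) * Real.exp (-(v / 2))) * Real.exp (-(v / 2)) := by ring
    _ = 8 * Real.exp (-(v / 2)) := by rw [h6, mul_one]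

/-- The density is at most z^{-3/2}, which is integrable at infinity with primitive -2z^{-1/2}. -/
theorem lateralProfile_le (y : ℝ) : lateralProfile y ≤ lateralProfile 1 + 2 := by
  rcases le_total y 1 with h | h
  · linarith [monotone_lateralProfile h]
  have hanti : AntitoneOn (fun z => lateralProfile z + 2 * z ^ (-(1 / 2) : ℝ)) (Ici 1) := by
    have hd : ∀ z ∈ Ici (1 : ℝ), HasDerivAt (fun z => lateralProfile z + 2 * z ^ (-(1 / 2) : ℝ))
        (flatProfile z - z ^ (-(3 / 2) : ℝ)) z := by
      intro z hz
      have hz0 : (0 : ℝ) < z := lt_of_lt_of_le one_pos hz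
      have := (hasDerivAt_lateralProfile z).add
        ((Real.hasDerivAt_rpow_const (p := -(1 / 2)) (Or.inl hz0.ne')).const_mul 2)
      refine (this.congr_deriv ?_ :)
      norm_num
      ring
    refine antitoneOn_of_deriv_nonpos (convex_Ici 1)
      (fun z hz => (hd z hz).continuousAt.continuousWithinAt)
      (fun z hz => (hd z (interior_subset hz)).differentiableAt.differentiableWithinAt) ?_
    intro z hz
    have hz1 : (1 : ℝ) ≤ z := interior_subset hz
    have hz0 : (0 : ℝ) < z := by linarith
    rw [(hd z hz1).deriv, flatProfile_of_pos hz0]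
    have h1 : Real.exp (-z⁻¹) ≤ 1 := Real.exp_le_one_iff.2 (by simp; positivity)
    have h2 : 0 ≤ z ^ (-(3 / 2) : ℝ) := by positivity
    nlinarith
  have := hanti (mem_Ici.2 le_rfl) h h
  simp only [Real.one_rpow] at this
  have h2 : 0 ≤ y ^ (-(1 / 2) : ℝ) := by positivity
  linarith

theorem exists_tendsto_lateralProfile :
    ∃ L > 0, Tendsto lateralProfile atTop (𝓝 L) ∧ ∀ y, lateralProfile y ≤ L := by
  have hb : BddAbove (range lateralProfile) := ⟨_, by rintro _ ⟨y, rfl⟩; exact lateralProfile_le y⟩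
  exact ⟨_, (lateralProfile_pos one_pos).trans_le (le_ciSup hb 1),
    tendsto_atTop_ciSup monotone_lateralProfile hb, le_ciSup hb⟩

/-- This equation makes the kernel caloric. It is multiplied through by 2y² so that it also holds
for y ≤ 0, that is, before the starting time. -/
theorem hasDerivAt_flatProfile (y : ℝ) :
    ∃ d, HasDerivAt flatProfile d y ∧ 2 * y ^ 2 * d = (2 - 3 * y) * flatProfile y := by
  have hd := (contDiff_flatProfile.differentiable (by norm_num) y).hasDerivAt
  refine ⟨_, hd, ?_⟩
  rcases lt_trichotomy y 0 with h | rfl | h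
  · have : flatProfile =ᶠ[𝓝 y] fun _ => 0 := by
      filter_upwards [Iio_mem_nhds h] with z hz using flatProfile_of_nonpos (le_of_lt hz)
    rw [this.deriv_eq, flatProfile_of_nonpos h.le]
    simp
  · simp [flatProfile_of_nonpos]
  · have h1 : flatProfile =ᶠ[𝓝 y] fun z => z ^ (-(3 / 2) : ℝ) * Real.exp (-z⁻¹) := by
      filter_upwards [Ioi_mem_nhds h] with z hz using flatProfile_of_pos hz
    have h2 := (Real.hasDerivAt_rpow_const (p := -(3 / 2)) (Or.inl h.ne')).mul
      (hasDerivAt_inv h.ne').neg.exp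
    rw [h1.deriv_eq, flatProfile_of_pos h]
    have h3 : y ^ (-(3 / 2) - 1 : ℝ) = y ^ (-(3 / 2) : ℝ) * y⁻¹ := by
      rw [Real.rpow_sub_one h.ne']; rfl
    have h4 : deriv (fun z : ℝ => z ^ (-(3 / 2) : ℝ) * Real.exp (-z⁻¹)) y = _ := h2.deriv
    rw [h4, h3]
    simp only [Pi.neg_apply]
    field_simp
    ring

/-- The caloric function on `r > 0` with constant lateral value at `r = 0` and zero initial
value, up to normalization. -/
noncomputable def lateralKernel (ε r τ : ℝ) : ℝ := lateralProfile (4 * ε * τ / r ^ 2)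

theorem heatAt_lateralKernel {ε c s x t : ℝ} (hx : x < c) :
    HeatAt ε (fun z => lateralKernel ε (c - z.1) (z.2 - s)) x t := by
  set y : ℝ → ℝ → ℝ := fun x t => 4 * ε * (t - s) / (c - x) ^ 2 with hy
  have hyx : ∀ z < c, HasDerivAt (fun z => y z t) (2 * y z t / (c - z)) z := by
    intro z hz
    have hz' : c - z ≠ 0 := by linarith
    have h1 := ((hasDerivAt_id z).const_sub c).pow 2
    have h2 := (hasDerivAt_const z (4 * ε * (t - s))).div h1 (pow_ne_zero 2 hz')
    refine (h2.congr_deriv ?_ :)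
    simp only [hy, Pi.pow_apply, id]
    field_simp
    ring
  have hyt : HasDerivAt (fun r => y x r) (4 * ε / (c - x) ^ 2) t := by
    have := (((hasDerivAt_id t).sub_const s).const_mul (4 * ε)).div_const ((c - x) ^ 2)
    simpa [hy] using this
  have hxx : HasDerivAt (fun z => flatProfile (y z t) * (2 * y z t / (c - z)))
      (4 * flatProfile (y x t) / (c - x) ^ 2) x := by
    obtain ⟨d, hd, hd'⟩ := hasDerivAt_flatProfile (y x t)
    have hx' : c - x ≠ 0 := by linarith
    have h1 : HasDerivAt (fun z => flatProfile (y z t)) (d * (2 * y x t / (c - x))) x :=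
      HasDerivAt.comp (h₂ := flatProfile) (h := fun z => y z t) x hd (hyx x hx)
    have h2 := h1.mul (((hyx x hx).const_mul 2).div ((hasDerivAt_id x).const_sub c) hx')
    refine (h2.congr_deriv ?_ :)
    simp only [id, Pi.div_apply]
    generalize flatProfile (y x t) = p at hd' ⊢
    generalize y x t = v at hd' ⊢
    field_simp
    linear_combination 2 * hd'
  refine HeatAt.of_hasDerivAt (τ := flatProfile (y x t) * (4 * ε / (c - x) ^ 2))
    (X := 4 * flatProfile (y x t) / (c - x) ^ 2) ?_ ?_ ?_ hxx ?_
  · refine contDiff_lateralProfile.contDiffAt.comp _ ?_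
    refine ContDiffAt.div (by fun_prop) (by fun_prop) ?_
    exact pow_ne_zero 2 (sub_pos.2 hx).ne'
  · exact HasDerivAt.comp t (hasDerivAt_lateralProfile (y x t)) hyt
  · filter_upwards [Iio_mem_nhds hx] with z hz
    exact HasDerivAt.comp z (hasDerivAt_lateralProfile (y z t)) (hyx z hz)
  · ring

theorem lateralKernel_of_nonpos {ε r τ : ℝ} (hε : 0 < ε) (h : τ ≤ 0) :
    lateralKernel ε r τ = 0 := by
  refine lateralProfile_of_nonpos (div_nonpos_of_nonpos_of_nonneg ?_ (sq_nonneg r))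
  nlinarith

theorem lateralKernel_nonneg (ε r τ : ℝ) : 0 ≤ lateralKernel ε r τ := lateralProfile_nonneg _

theorem lateralKernel_mono {ε r τ τ' : ℝ} (hε : 0 < ε) (h : τ ≤ τ') :
    lateralKernel ε r τ ≤ lateralKernel ε r τ' :=
  monotone_lateralProfile (by gcongr)

theorem hasDerivAt_lateralKernel (ε r t s : ℝ) :
    HasDerivAt (fun s => lateralKernel ε r (t - s))
      (-(flatProfile (4 * ε * (t - s) / r ^ 2) * (4 * ε / r ^ 2))) s := by
  have h := (((hasDerivAt_id s).const_sub t).const_mul (4 * ε)).div_const (r ^ 2)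
  have := HasDerivAt.comp s (hasDerivAt_lateralProfile (4 * ε * (t - s) / r ^ 2)) h
  refine (this.congr_deriv ?_ :)
  ring

/-- Far away, the lateral kernel is much smaller than the lateral kernel at later times. -/
theorem exists_flatProfile_le {ε t₁ A : ℝ} (x : ℝ) (hε : 0 < ε) (ht₁ : 0 < t₁) (hA : 0 < A) :
    ∃ R₀ : ℝ, ∀ R ≥ R₀, ∀ δ ∈ Ioc (0 : ℝ) 1, ∀ s ∈ Icc 0 t₁, ∀ t ≤ t₁,
      flatProfile (4 * ε * (t - s) / (R - x + δ) ^ 2) * (4 * ε / (R - x + δ) ^ 2)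
        ≤ A * (flatProfile (4 * ε * (65 * t₁ - s) / (R + δ) ^ 2) * (4 * ε / (R + δ) ^ 2)) := by
  have hlim : Tendsto (fun R : ℝ => 128 * Real.exp (-(R ^ 2 / (64 * ε * t₁)))) atTop (𝓝 0) := by
    have h1 : Tendsto (fun R : ℝ => R ^ 2 / (64 * ε * t₁)) atTop atTop :=
      (tendsto_pow_atTop two_ne_zero).atTop_div_const (by positivity)
    simpa using (Real.tendsto_exp_neg_atTop_nhds_zero.comp h1).const_mul 128
  have hlim2 : Tendsto (fun R : ℝ => R ^ 2) atTop atTop := tendsto_pow_atTop two_ne_zero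
  obtain ⟨R₀, hR₀⟩ := eventually_atTop.1 ((hlim.eventually (gt_mem_nhds hA)).and
    ((hlim2.eventually_ge_atTop (260 * ε * t₁)).and
      ((eventually_ge_atTop 1).and (eventually_ge_atTop (2 * |x|)))))
  refine ⟨R₀, fun R hR δ hδ s hs t ht => ?_⟩
  obtain ⟨hRA, hR2, hR1, hRx⟩ := hR₀ R hR
  have hxx := le_abs_self x
  have hR0 : 0 < R := by linarith
  set ρ₁ := R - x + δ with hρ₁
  set ρ₂ := R + δ with hρ₂
  have hρ1 : R / 2 ≤ ρ₁ := by linarith [hδ.1]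
  have hρ1p : 0 < ρ₁ := by linarith
  have hρ2 : R ≤ ρ₂ := by linarith [hδ.1]
  have hρ2' : ρ₂ ≤ 2 * R := by linarith [hδ.2]
  have hρ2p : 0 < ρ₂ := by linarith
  have hsq1 : R ^ 2 / 4 ≤ ρ₁ ^ 2 := by nlinarith
  have hsq2 : ρ₂ ^ 2 ≤ 4 * R ^ 2 := by nlinarith
  have hsq3 : R ^ 2 ≤ ρ₂ ^ 2 := by nlinarith
  -- Near the fixed point the distance is at least R/2 and the elapsed time at most t₁, giving at
  -- most 8E². At the origin the distance is at most 2R and the elapsed time at least 64t₁, giving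
  -- at least E. The surplus factor E tends to 0.
  set E := Real.exp (-(R ^ 2 / (64 * ε * t₁))) with hE
  have hEp : 0 < E := Real.exp_pos _
  have hleft : flatProfile (4 * ε * (t - s) / ρ₁ ^ 2) ≤ 8 * (E * E) := by
    rcases le_or_gt t s with h | h
    · rw [flatProfile_of_nonpos]
      · positivity
      · exact div_nonpos_of_nonpos_of_nonneg (by nlinarith) (sq_nonneg _)
    · have hy : 0 < 4 * ε * (t - s) / ρ₁ ^ 2 :=
        div_pos (mul_pos (by positivity) (by linarith)) (by positivity)
      refine (flatProfile_le hy).trans ?_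
      rw [← Real.exp_add]
      gcongr
      have e : (2 * (4 * ε * (t - s) / ρ₁ ^ 2))⁻¹ = ρ₁ ^ 2 / (8 * ε * (t - s)) := by
        field_simp; ring
      rw [e]
      have h1 : (R ^ 2 / 4) / (8 * ε * t₁) ≤ ρ₁ ^ 2 / (8 * ε * (t - s)) := by
        have : 0 < t - s := by linarith
        gcongr
        linarith [hs.1]
      have h2 : (R ^ 2 / 4) / (8 * ε * t₁)
          = R ^ 2 / (64 * ε * t₁) + R ^ 2 / (64 * ε * t₁) := by field_simp; ring
      linarith
  have hright : E ≤ flatProfile (4 * ε * (65 * t₁ - s) / ρ₂ ^ 2) := by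
    have hτ : 64 * t₁ ≤ 65 * t₁ - s := by linarith [hs.2]
    have hτ' : 0 < 65 * t₁ - s := by linarith
    have hy : 0 < 4 * ε * (65 * t₁ - s) / ρ₂ ^ 2 := by positivity
    have hy1 : 4 * ε * (65 * t₁ - s) / ρ₂ ^ 2 ≤ 1 := by
      rw [div_le_one (by positivity)]
      nlinarith [hs.1]
    rw [flatProfile_of_pos hy]
    have h1 : 1 ≤ (4 * ε * (65 * t₁ - s) / ρ₂ ^ 2) ^ (-(3 / 2) : ℝ) :=
      Real.one_le_rpow_of_pos_of_le_one_of_nonpos hy hy1 (by norm_num)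
    have h2 : E ≤ Real.exp (-(4 * ε * (65 * t₁ - s) / ρ₂ ^ 2)⁻¹) := by
      rw [hE]
      gcongr
      rw [inv_div]
      calc ρ₂ ^ 2 / (4 * ε * (65 * t₁ - s)) ≤ (4 * R ^ 2) / (4 * ε * (64 * t₁)) := by gcongr
        _ = R ^ 2 / (64 * ε * t₁) := by field_simp
    calc E ≤ Real.exp (-(4 * ε * (65 * t₁ - s) / ρ₂ ^ 2)⁻¹) := h2
      _ ≤ _ := le_mul_of_one_le_left (Real.exp_pos _).le h1
  have hfp := flatProfile_nonneg (4 * ε * (65 * t₁ - s) / ρ₂ ^ 2)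
  calc flatProfile (4 * ε * (t - s) / ρ₁ ^ 2) * (4 * ε / ρ₁ ^ 2)
      ≤ (8 * (E * E)) * (4 * ε / (R ^ 2 / 4)) := by
        gcongr
    _ = (128 * E) * (E * (4 * ε / (4 * R ^ 2))) := by field_simp; ring
    _ ≤ A * (flatProfile (4 * ε * (65 * t₁ - s) / ρ₂ ^ 2) * (4 * ε / ρ₂ ^ 2)) := by
        gcongr

/-- The pointwise bound between the densities in s, integrated over [s, s']. -/
theorem exists_lateralKernel_sub_le {ε t₁ A : ℝ} (x : ℝ) (hε : 0 < ε) (ht₁ : 0 < t₁)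
    (hA : 0 < A) :
    ∃ R₀ : ℝ, ∀ R ≥ R₀, ∀ δ ∈ Ioc (0 : ℝ) 1, ∀ s s' : ℝ, 0 ≤ s → s ≤ s' → s' ≤ t₁ → ∀ t ≤ t₁,
      lateralKernel ε (R - x + δ) (t - s) - lateralKernel ε (R - x + δ) (t - s')
        ≤ A * (lateralKernel ε (R + δ) (65 * t₁ - s) - lateralKernel ε (R + δ) (65 * t₁ - s')) := by
  obtain ⟨R₀, hR₀⟩ := exists_flatProfile_le x hε ht₁ hA
  refine ⟨R₀, fun R hR δ hδ s s' hs hss hs' t ht => ?_⟩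
  have hd : ∀ r, HasDerivAt (fun r => A * lateralKernel ε (R + δ) (65 * t₁ - r)
      - lateralKernel ε (R - x + δ) (t - r)) _ r := fun r =>
    ((hasDerivAt_lateralKernel ε (R + δ) (65 * t₁) r).const_mul A).sub
      (hasDerivAt_lateralKernel ε (R - x + δ) t r)
  have hanti : AntitoneOn (fun r => A * lateralKernel ε (R + δ) (65 * t₁ - r)
      - lateralKernel ε (R - x + δ) (t - r)) (Icc 0 t₁) := by
    refine antitoneOn_of_deriv_nonpos (convex_Icc 0 t₁)
      (fun r _ => (hd r).continuousAt.continuousWithinAt)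
      (fun r _ => (hd r).differentiableAt.differentiableWithinAt) fun r hr => ?_
    rw [(hd r).deriv]
    have := hR₀ R hR δ hδ r (interior_subset hr) t ht
    linarith
  have := hanti ⟨hs, hss.trans hs'⟩ ⟨hs.trans hss, hs'⟩ hss
  simp only at this
  linarith

/-! ### Riemann–Stieltjes sums against an almost concentrated mass -/

section StieltjesSums

variable {G : ℝ → ℝ} {m : ℕ → ℝ} {n : ℕ} {h t ρ : ℝ}

/-- The increments of G are masses of total at most L. Samples within ρ before t are at most 2a; the
older ones are at most M and carry only the mass of G beyond ρ/2, which the truncation `G'`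
isolates. -/
theorem sum_mul_sub_le {a L M : ℝ} (hG : Monotone G) (hG0 : ∀ τ ≤ 0, G τ = 0) (hGL : ∀ τ, G τ ≤ L)
    (hh : 0 ≤ h) (hhρ : h ≤ ρ / 2) (ha : 0 ≤ a) (hM : ∀ i < n, m i ≤ M) (hM0 : 0 ≤ M)
    (hm : ∀ i < n, i * h < t → t - ρ ≤ i * h → m i ≤ 2 * a) :
    ∑ i ∈ Finset.range n, m i * (G (t - i * h) - G (t - (i + 1 : ℕ) * h))
      ≤ 2 * a * L + M * (L - G (ρ / 2)) := by
  have hGn : ∀ τ, 0 ≤ G τ := fun τ => by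
    rw [← hG0 (min τ 0) (min_le_right _ _)]; exact hG (min_le_left _ _)
  set G' : ℝ → ℝ := fun τ => max (G τ) (G (ρ / 2)) with hG'
  have hstep : ∀ i : ℕ, t - (i + 1 : ℕ) * h ≤ t - i * h := fun i => by push_cast; linarith
  have hterm : ∀ i ∈ Finset.range n, m i * (G (t - i * h) - G (t - (i + 1 : ℕ) * h))
      ≤ 2 * a * (G (t - i * h) - G (t - (i + 1 : ℕ) * h))
        + M * (G' (t - i * h) - G' (t - (i + 1 : ℕ) * h)) := by
    intro i hi
    rw [Finset.mem_range] at hi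
    have h1 : 0 ≤ G (t - i * h) - G (t - (i + 1 : ℕ) * h) := sub_nonneg.2 (hG (hstep i))
    have h2 : 0 ≤ G' (t - i * h) - G' (t - (i + 1 : ℕ) * h) :=
      sub_nonneg.2 (max_le_max_right _ (hG (hstep i)))
    rcases le_or_gt t (i * h) with hit | hit
    · have e1 : G (t - i * h) = 0 := hG0 _ (by linarith)
      have e2 : G (t - (i + 1 : ℕ) * h) = 0 := hG0 _ ((hstep i).trans (by linarith))
      rw [e1, e2] at h1 ⊢
      nlinarith [mul_nonneg hM0 h2]
    rcases le_or_gt (t - ρ) (i * h) with hiρ | hiρ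
    · nlinarith [mul_nonneg hM0 h2, mul_nonneg (sub_nonneg.2 (hm i hi hit hiρ)) h1]
    · have e1 : G' (t - (i + 1 : ℕ) * h) = G (t - (i + 1 : ℕ) * h) :=
        max_eq_left (hG (by push_cast; linarith))
      have e2 : G' (t - i * h) = G (t - i * h) := max_eq_left (hG (by linarith))
      rw [e1, e2]
      nlinarith [mul_nonneg (sub_nonneg.2 (hM i hi)) h1, mul_nonneg ha h1]
  refine (Finset.sum_le_sum hterm).trans ?_
  rw [Finset.sum_add_distrib, ← Finset.mul_sum, ← Finset.mul_sum,
    Finset.sum_range_sub' (fun i : ℕ => G (t - i * h)),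
    Finset.sum_range_sub' (fun i : ℕ => G' (t - i * h))]
  have h1 : G (t - (0 : ℕ) * h) - G (t - n * h) ≤ L := by linarith [hGL (t - (0 : ℕ) * h), hGn (t - n * h)]
  have h2 : G' (t - (0 : ℕ) * h) - G' (t - n * h) ≤ L - G (ρ / 2) := by
    exact sub_le_sub (max_le (hGL _) (hGL _)) (le_max_right _ _)
  gcongr

/-- Only the mass of G on [0, ρ/2] is kept, by truncating with a minimum. The samples it meets lie
within ρ before t, because h ≤ ρ/2. -/
theorem le_sum_mul_sub {a : ℝ} (hG : Monotone G) (hG0 : ∀ τ ≤ 0, G τ = 0)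
    (hh : 0 ≤ h) (hhρ : h ≤ ρ / 2) (ha : 0 ≤ a) (hm0 : ∀ i < n, 0 ≤ m i) (htρ : ρ / 2 ≤ t)
    (htn : t ≤ n * h)
    (hm : ∀ i < n, i * h < t → t - ρ ≤ i * h → a ≤ 2 * m i) :
    a / 2 * G (ρ / 2) ≤ ∑ i ∈ Finset.range n, m i * (G (t - i * h) - G (t - (i + 1 : ℕ) * h)) := by
  have hGn : ∀ τ, 0 ≤ G τ := fun τ => by
    rw [← hG0 (min τ 0) (min_le_right _ _)]; exact hG (min_le_left _ _)
  set G' : ℝ → ℝ := fun τ => min (G τ) (G (ρ / 2)) with hG'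
  have hstep : ∀ i : ℕ, t - (i + 1 : ℕ) * h ≤ t - i * h := fun i => by push_cast; linarith
  have hterm : ∀ i ∈ Finset.range n, a / 2 * (G' (t - i * h) - G' (t - (i + 1 : ℕ) * h))
      ≤ m i * (G (t - i * h) - G (t - (i + 1 : ℕ) * h)) := by
    intro i hi
    rw [Finset.mem_range] at hi
    have h1 : 0 ≤ G (t - i * h) - G (t - (i + 1 : ℕ) * h) := sub_nonneg.2 (hG (hstep i))
    rcases le_or_gt (ρ / 2) (t - (i + 1 : ℕ) * h) with hfar | hnear
    · have e1 : G' (t - (i + 1 : ℕ) * h) = G (ρ / 2) := min_eq_right (hG hfar)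
      have e2 : G' (t - i * h) = G (ρ / 2) := min_eq_right (hG (hfar.trans (hstep i)))
      rw [e1, e2, sub_self, mul_zero]
      exact mul_nonneg (hm0 i hi) h1
    rcases le_or_gt t (i * h) with hit | hit
    · have e1 : G (t - i * h) = 0 := hG0 _ (by linarith)
      have e2 : G (t - (i + 1 : ℕ) * h) = 0 := hG0 _ ((hstep i).trans (by linarith))
      simp only [hG', e1, e2, sub_self, mul_zero, le_refl]
    have h2 : G' (t - i * h) - G' (t - (i + 1 : ℕ) * h)
        ≤ G (t - i * h) - G (t - (i + 1 : ℕ) * h) := by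
      have e1 : G' (t - (i + 1 : ℕ) * h) = G (t - (i + 1 : ℕ) * h) := min_eq_left (hG hnear.le)
      rw [e1]
      linarith [min_le_left (G (t - i * h)) (G (ρ / 2))]
    have h3 := hm i hi hit (by push_cast at hnear; linarith)
    calc a / 2 * (G' (t - i * h) - G' (t - (i + 1 : ℕ) * h))
        ≤ a / 2 * (G (t - i * h) - G (t - (i + 1 : ℕ) * h)) := by gcongr
      _ ≤ _ := by gcongr; linarith
  refine le_trans (le_of_eq ?_) (Finset.sum_le_sum hterm)
  rw [← Finset.mul_sum, Finset.sum_range_sub' (fun i : ℕ => G' (t - i * h))]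
  have e1 : G' (t - (0 : ℕ) * h) = G (ρ / 2) := min_eq_right (hG (by simpa using htρ))
  have e2 : G' (t - n * h) = 0 := by
    have : G (t - n * h) = 0 := hG0 _ (by linarith)
    simp [hG', this, hGn]
  rw [e1, e2, sub_zero]

end StieltjesSums

/-! ### Caloric functions generated by lateral data, and the barrier -/

/-- The caloric function with lateral values `m i` at `x = R` for times in `[i h, (i + 1) h]`,
up to normalization and a shift by `δ`. -/
noncomputable def lateralSum (ε R δ h : ℝ) (n : ℕ) (m : ℕ → ℝ) (z : ℝ × ℝ) : ℝ :=
  ∑ i ∈ Finset.range n, m i * (lateralKernel ε (R - z.1 + δ) (z.2 - i * h)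
    - lateralKernel ε (R - z.1 + δ) (z.2 - (i + 1 : ℕ) * h))

section LateralSum

variable {ε R δ h : ℝ} {n : ℕ} {m : ℕ → ℝ}

theorem heatAt_lateralSum {x t : ℝ} (hx : x < R + δ) :
    HeatAt ε (lateralSum ε R δ h n m) x t := by
  have e : lateralSum ε R δ h n m = fun z => ∑ i ∈ Finset.range n,
      m i * (lateralKernel ε (R + δ - z.1) (z.2 - i * h)
        - lateralKernel ε (R + δ - z.1) (z.2 - (i + 1 : ℕ) * h)) := by
    funext z
    simp only [lateralSum, sub_add_eq_add_sub]
  rw [e]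
  exact HeatAt.sum _ fun i _ => ((heatAt_lateralKernel hx).sub (heatAt_lateralKernel hx)).const_mul _

theorem lateralSum_nonneg (hε : 0 < ε) (hh : 0 ≤ h) (hm : ∀ i < n, 0 ≤ m i) (z : ℝ × ℝ) :
    0 ≤ lateralSum ε R δ h n m z :=
  Finset.sum_nonneg fun i hi => mul_nonneg (hm i (Finset.mem_range.1 hi))
    (sub_nonneg.2 (lateralKernel_mono hε (by push_cast; linarith)))

theorem lateralSum_eq_zero (hε : 0 < ε) (hh : 0 ≤ h) {x t : ℝ} (ht : t ≤ 0) :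
    lateralSum ε R δ h n m (x, t) = 0 := by
  refine Finset.sum_eq_zero fun i _ => ?_
  have : 0 ≤ i * h := by positivity
  rw [lateralKernel_of_nonpos hε (by simp only; linarith),
    lateralKernel_of_nonpos hε (by push_cast; linarith)]
  simp

theorem lateralSum_le {M : ℝ} (hε : 0 < ε) (hh : 0 ≤ h) (hm : ∀ i < n, m i ≤ M) (hM : 0 ≤ M)
    (x t : ℝ) : lateralSum ε R δ h n m (x, t) ≤ M * lateralKernel ε (R - x + δ) t := by
  have : lateralSum ε R δ h n m (x, t) ≤ ∑ i ∈ Finset.range n,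
      M * (lateralKernel ε (R - x + δ) (t - i * h)
        - lateralKernel ε (R - x + δ) (t - (i + 1 : ℕ) * h)) := by
    refine Finset.sum_le_sum fun i hi => ?_
    refine mul_le_mul_of_nonneg_right (hm i (Finset.mem_range.1 hi))
      (sub_nonneg.2 (lateralKernel_mono hε ?_))
    push_cast; linarith
  refine this.trans ?_
  rw [← Finset.mul_sum, Finset.sum_range_sub' (fun i : ℕ => lateralKernel ε (R - x + δ) (t - i * h))]
  refine mul_le_mul_of_nonneg_left ?_ hM
  have := lateralKernel_nonneg ε (R - x + δ) (t - n * h)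
  simp only [Nat.cast_zero, zero_mul, sub_zero]
  linarith

end LateralSum

theorem tendsto_lateralKernel_atTop (ε c τ : ℝ) :
    Tendsto (fun r => lateralKernel ε (c + r) τ) atTop (𝓝 0) := by
  have h1 : Tendsto (fun r : ℝ => 4 * ε * τ / (c + r) ^ 2) atTop (𝓝 0) :=
    ((tendsto_pow_atTop two_ne_zero).comp
      (tendsto_atTop_add_const_left _ c tendsto_id)).const_div_atTop _
  have h2 := (contDiff_lateralProfile.continuous.tendsto 0).comp h1
  rwa [lateralProfile_of_nonpos le_rfl] at h2

/-- On a box [-l, R] with l large, the sum is below μ on the far left side. After subtracting μ,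
nonnegativity of w suffices there, so no growth information is needed. -/
theorem IsHeatSupersolution.lateralSum_le {ε : ℝ} {w : ℝ × ℝ → ℝ} {R δ h T C : ℝ} {n : ℕ}
    {m : ℕ → ℝ} (hε : 0 < ε) (hw : IsHeatSupersolution ε w)
    (hwc : ContinuousOn w (univ ×ˢ Ici 0)) (hpos : ∀ x t, 0 ≤ t → 0 ≤ w (x, t))
    (hδ : 0 < δ) (hh : 0 ≤ h) (hR : 0 ≤ R) (hC : 0 < C)
    (hlat : ∀ t ∈ Icc 0 T, lateralSum ε R δ h n m (R, t) ≤ C * w (R, t))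
    {t : ℝ} (ht : 0 ≤ t) (htT : t < T) :
    lateralSum ε R δ h n m (0, t) ≤ C * w (0, t) := by
  obtain ⟨M, hM⟩ := ((Finset.range n).image m).bddAbove
  set M' := max M 0 with hM'
  have hmM : ∀ i < n, m i ≤ M' := fun i hi =>
    (hM (Finset.mem_coe.2 (Finset.mem_image_of_mem m (Finset.mem_range.2 hi)))).trans (le_max_left _ _)
  refine le_of_forall_pos_le_add fun μ hμ => ?_
  have h1 : Tendsto (fun r => M' * lateralKernel ε (R + δ + r) T) atTop (𝓝 0) := by
    simpa using (tendsto_lateralKernel_atTop ε (R + δ) T).const_mul M'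
  obtain ⟨l, hlμ, hl0⟩ := ((h1.eventually (gt_mem_nhds hμ)).and (eventually_ge_atTop 0)).exists
  have hψ : ∀ x ∈ Icc (-l) R, ∀ t, HeatAt ε
      (fun z => C⁻¹ * (lateralSum ε R δ h n m z - μ)) x t := fun x hx t =>
    ((heatAt_lateralSum (by linarith [hx.2])).sub (HeatAt.const ε μ x t)).const_mul _
  have := hw.comparison (a := -l) (b := R) (t₀ := 0) (t₁ := T) le_rfl hwc
    (ψ := fun z => C⁻¹ * (lateralSum ε R δ h n m z - μ))
    (fun z hz => (hψ z.1 hz.1 z.2).1.continuousAt.continuousWithinAt)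
    (fun x hx t _ => hψ x (Ioo_subset_Icc_self hx) t) ?_ ?_ ?_ (x := 0) (t := t)
    ⟨by linarith, hR⟩ ⟨ht, htT⟩
  · rw [inv_mul_le_iff₀ hC] at this
    linarith
  · intro x _
    rw [lateralSum_eq_zero hε hh le_rfl, inv_mul_le_iff₀ hC]
    nlinarith [hpos x 0 le_rfl]
  · intro s hs
    rw [inv_mul_le_iff₀ hC]
    have h2 := _root_.lateralSum_le (R := R) (δ := δ) hε hh hmM (le_max_right _ _) (-l) s
    have h3 : lateralKernel ε (R - -l + δ) s ≤ lateralKernel ε (R + δ + l) T := by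
      rw [show R - -l + δ = R + δ + l by ring]
      exact lateralKernel_mono hε hs.2
    have h4 : M' * lateralKernel ε (R - -l + δ) s ≤ M' * lateralKernel ε (R + δ + l) T := by
      gcongr
    nlinarith [hpos (-l) s hs.1, mul_nonneg hC.le (hpos (-l) s hs.1)]
  · intro s hs
    rw [inv_mul_le_iff₀ hC]
    linarith [hlat s hs]

/-- A positive supersolution of the heat equation dominates, up to constants and an initial layer,
its own lateral data on `x = R` through a caloric function that is small at given points. -/
theorem IsHeatSupersolution.exists_lateral_barrier (ε : ℝ) (hε : 0 < ε) :
    ∃ C₁ > 0, ∃ C₂ > 0, ∀ (w : ℝ × ℝ → ℝ), IsHeatSupersolution ε w →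
      ContinuousOn w (univ ×ˢ Ici 0) → (∀ x t, 0 ≤ t → 0 < w (x, t)) →
      ∀ t₁ > 0, ∀ A > 0, ∀ x : ℝ, ∃ R₀ : ℝ, ∀ R ≥ R₀, ∀ H : ℝ → ℝ, ContinuousOn H (Icc 0 t₁) →
        w (R, 0) < H 0 → (∀ t ∈ Icc 0 t₁, 0 ≤ H t) →
        ∃ p : ℝ × ℝ → ℝ, (∀ y ≤ R, ∀ t, HeatAt ε p y t) ∧ (∀ z, 0 ≤ p z) ∧
          (∀ t ∈ Icc 0 t₁, w (R, t) ≤ H t + C₁ * p (R, t)) ∧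
          ∀ t ≤ t₁, p (x, t) ≤ A * (C₂ * w (0, 65 * t₁)) := by
  obtain ⟨L, hL, hLlim, hLle⟩ := exists_tendsto_lateralProfile
  have hf1 := lateralProfile_pos one_pos
  refine ⟨2 / lateralProfile 1, by positivity, 2 * L + 1, by positivity, ?_⟩
  intro w hw hwc hpos t₁ ht₁ A hA x
  obtain ⟨R₀, hR₀⟩ := exists_lateralKernel_sub_le x hε ht₁ hA
  refine ⟨max R₀ 0, fun R hR H hHc hH0 hHn => ?_⟩
  have hR0 : 0 ≤ R := (le_max_right _ _).trans hR
  have hRR : R₀ ≤ R := (le_max_left _ _).trans hR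
  set T := 66 * t₁ with hT
  have hvc : ContinuousOn (fun s => w (R, s)) (Icc 0 T) :=
    hwc.comp (by fun_prop) fun s hs => ⟨mem_univ _, hs.1⟩
  have hne : (Icc 0 T).Nonempty := nonempty_Icc.2 (by positivity)
  obtain ⟨a, ha, hamin⟩ := isCompact_Icc.exists_isMinOn hne hvc
  obtain ⟨b, hb, hbmax⟩ := isCompact_Icc.exists_isMaxOn hne hvc
  set m₀ := w (R, a) with hm₀
  set M := w (R, b) with hM
  have hm₀p : 0 < m₀ := hpos R a ha.1
  have hMp : 0 < M := hpos R b hb.1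
  obtain ⟨ρ₁, hρ₁, hunif⟩ := Metric.uniformContinuousOn_iff.1
    (isCompact_Icc.uniformContinuousOn_of_continuous hvc) m₀ hm₀p
  obtain ⟨ρ₂, hρ₂, hinit⟩ : ∃ ρ > 0, ∀ s ∈ Icc 0 t₁, s < ρ → w (R, s) ≤ H s := by
    have hc : ContinuousOn (fun s => H s - w (R, s)) (Icc 0 t₁) :=
      hHc.sub (hvc.mono (Icc_subset_Icc le_rfl (by linarith)))
    have := hc 0 ⟨le_rfl, ht₁.le⟩
    obtain ⟨ρ, hρ, hρ'⟩ := Metric.continuousWithinAt_iff.1 this _ (sub_pos.2 hH0)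
    refine ⟨ρ, hρ, fun s hs hsρ => ?_⟩
    have := hρ' hs (by simpa [abs_of_nonneg hs.1] using hsρ)
    rw [Real.dist_eq] at this
    linarith [(abs_lt.1 this).1]
  -- Over times ρ the values of w on x = R change by at most a factor 2, since they stay above m₀.
  -- For times below ρ/2, where the kernel has not yet filled up, w is still below H.
  set ρ := min (ρ₁ / 2) ρ₂ with hρ
  have hρp : 0 < ρ := lt_min (by linarith) hρ₂
  have hρ1 : ρ < ρ₁ := (min_le_left _ _).trans_lt (by linarith)
  have hcomp : ∀ s ∈ Icc 0 T, ∀ s' ∈ Icc 0 T, |s - s'| ≤ ρ → w (R, s) ≤ 2 * w (R, s') := by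
    intro s hs s' hs' hss
    have h1 := hunif s hs s' hs' (by rw [Real.dist_eq]; linarith)
    rw [Real.dist_eq] at h1
    have h2 : m₀ ≤ w (R, s') := hamin hs'
    linarith [(abs_lt.1 h1).2]
  obtain ⟨Y, hY⟩ := eventually_atTop.1
    (hLlim.eventually (lt_mem_nhds (show L - m₀ / M < L by linarith [div_pos hm₀p hMp])))
  -- A small shift δ concentrates the mass of the kernel in [0, ρ/2]: at least `lateralProfile 1`
  -- lies there, and at most m₀/M remains outside. The error M · (m₀/M) is then at most the value of
  -- w itself, whence the constant 2L + 1.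
  obtain ⟨δ, hδ, hδY⟩ : ∃ δ ∈ Ioc (0 : ℝ) 1, max 1 Y ≤ 4 * ε * (ρ / 2) / δ ^ 2 := by
    have h1 : 0 < max 1 Y := one_pos.trans_le (le_max_left _ _)
    set q := 4 * ε * (ρ / 2) / max 1 Y with hq
    have hq0 : 0 < q := by positivity
    refine ⟨min 1 q, ⟨lt_min one_pos hq0, min_le_left _ _⟩, ?_⟩
    have h2 : min 1 q ^ 2 ≤ q := by
      have h3 : 0 < min 1 q := lt_min one_pos hq0
      nlinarith [min_le_left 1 q, min_le_right 1 q]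
    rw [le_div_iff₀ (pow_pos (lt_min one_pos hq0) 2)]
    calc max 1 Y * min 1 q ^ 2 ≤ max 1 Y * q := by gcongr
      _ = 4 * ε * (ρ / 2) := by rw [hq]; field_simp
  set G : ℝ → ℝ := fun τ => lateralKernel ε δ τ with hG
  have hGm : Monotone G := fun τ τ' h => lateralKernel_mono hε h
  have hG0 : ∀ τ ≤ 0, G τ = 0 := fun τ h => lateralKernel_of_nonpos hε h
  have hGL : ∀ τ, G τ ≤ L := fun τ => hLle _
  have hGρ : lateralProfile 1 ≤ G (ρ / 2) :=
    monotone_lateralProfile ((le_max_left _ _).trans hδY)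
  have hGρL : L - G (ρ / 2) ≤ m₀ / M := by
    have := hY _ ((le_max_right _ _).trans hδY)
    simp only [hG, lateralKernel]
    linarith
  obtain ⟨n, hn⟩ := exists_nat_gt (t₁ / (ρ / 2))
  have hn0 : (0 : ℝ) < n := lt_trans (by positivity) hn
  set h := t₁ / n with hh
  have hhp : 0 < h := by positivity
  have hnh : n * h = t₁ := by rw [hh]; field_simp
  have hhρ : h ≤ ρ / 2 := by
    rw [hh, div_le_iff₀ hn0]
    rw [div_lt_iff₀ (by positivity)] at hn
    linarith
  set m : ℕ → ℝ := fun i => w (R, i * h) with hm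
  have hi0 : ∀ i : ℕ, 0 ≤ i * h := fun i => by positivity
  have hit : ∀ i < n, i * h ≤ t₁ := fun i hi => by
    rw [← hnh]
    gcongr
  have hiT : ∀ i < n, i * h ∈ Icc 0 T := fun i hi => ⟨hi0 i, (hit i hi).trans (by linarith)⟩
  have hm0 : ∀ i < n, 0 ≤ m i := fun i _ => (hpos R _ (hi0 i)).le
  have hmM : ∀ i < n, m i ≤ M := fun i hi => hbmax (hiT i hi)
  have hlat : ∀ t, lateralSum ε R δ h n m (R, t) = ∑ i ∈ Finset.range n,
      m i * (G (t - i * h) - G (t - (i + 1 : ℕ) * h)) := by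
    intro t
    simp [lateralSum, hG]
  refine ⟨lateralSum ε R δ h n m, fun y hy t => heatAt_lateralSum (by linarith [hδ.1]),
    lateralSum_nonneg hε hhp.le hm0, fun t ht => ?_, fun t ht => ?_⟩
  · rcases lt_or_ge t (ρ / 2) with htρ | htρ
    · have h1 := hinit t ht (by linarith [min_le_right (ρ₁ / 2) ρ₂])
      have h2 : 0 ≤ 2 / lateralProfile 1 * lateralSum ε R δ h n m (R, t) :=
        mul_nonneg (by positivity) (lateralSum_nonneg hε hhp.le hm0 _)
      linarith
    · have htT : t ∈ Icc 0 T := ⟨ht.1, ht.2.trans (by linarith)⟩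
      have h1 := le_sum_mul_sub (a := w (R, t)) (m := m) (n := n) hGm hG0 hhp.le hhρ
        (hpos R t ht.1).le hm0 htρ (by rw [hnh]; exact ht.2) fun i hi hlt hge =>
          hcomp t htT _ (hiT i hi) (by rw [abs_le]; constructor <;> linarith)
      rw [← hlat] at h1
      have h2 : w (R, t) / 2 * lateralProfile 1 ≤ lateralSum ε R δ h n m (R, t) :=
        (mul_le_mul_of_nonneg_left hGρ (by linarith [hpos R t ht.1])).trans h1
      have h3 : w (R, t) ≤ 2 / lateralProfile 1 * lateralSum ε R δ h n m (R, t) := by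
        rw [div_mul_eq_mul_div, le_div_iff₀ hf1]
        linarith
      linarith [hHn t ht]
  · have hlow : lateralSum ε R δ h n m (0, 65 * t₁) ≤ (2 * L + 1) * w (0, 65 * t₁) := by
      refine hw.lateralSum_le hε hwc (fun x t ht => (hpos x t ht).le) hδ.1 hhp.le hR0
        (by positivity) (T := T) ?_ (by positivity) (by linarith)
      intro s hs
      rw [hlat]
      have h1 := sum_mul_sub_le (a := w (R, s)) (m := m) (n := n) (M := M) hGm hG0 hGL hhp.le hhρ
        (hpos R s hs.1).le hmM hMp.le (t := s) fun i hi hlt hge =>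
          hcomp _ (hiT i hi) s hs (by rw [abs_le]; constructor <;> linarith)
      have h2 : M * (L - G (ρ / 2)) ≤ m₀ := by
        calc M * (L - G (ρ / 2)) ≤ M * (m₀ / M) := by gcongr
          _ = m₀ := by field_simp
      have h3 : m₀ ≤ w (R, s) := hamin hs
      linarith
    calc lateralSum ε R δ h n m (x, t) ≤ A * lateralSum ε R δ h n m (0, 65 * t₁) := by
          rw [lateralSum, lateralSum, Finset.mul_sum]
          refine Finset.sum_le_sum fun i hi => ?_
          have hi' := Finset.mem_range.1 hi
          have h1 := hR₀ R hRR δ hδ (i * h) ((i + 1 : ℕ) * h) (hi0 i) (by push_cast; linarith)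
            (by rw [← hnh]; gcongr; exact hi') t ht
          simp only [sub_zero]
          calc _ ≤ m i * (A * _) := mul_le_mul_of_nonneg_left h1 (hm0 i hi')
            _ = _ := by ring
      _ ≤ A * ((2 * L + 1) * w (0, 65 * t₁)) := by gcongr

/-! ### Gaussian distribution function -/

/-- The distribution function of the Gaussian measure with density `exp (-s ^ 2) / √π`. -/
noncomputable def gaussCDF (z : ℝ) : ℝ :=
  1 / 2 + (∫ s in (0 : ℝ)..z, Real.exp (-s ^ 2)) / √Real.pi

theorem hasDerivAt_gaussCDF (z : ℝ) :
    HasDerivAt gaussCDF (Real.exp (-z ^ 2) / √Real.pi) z := by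
  have hc : Continuous fun s : ℝ => Real.exp (-s ^ 2) := by fun_prop
  exact ((intervalIntegral.integral_hasDerivAt_right (hc.intervalIntegrable _ _)
    (hc.stronglyMeasurableAtFilter _ _) hc.continuousAt).div_const _).const_add _

theorem contDiff_gaussCDF : ContDiff ℝ 2 gaussCDF := by
  have h : (2 : WithTop ℕ∞) = 1 + 1 := by norm_num
  rw [h, contDiff_succ_iff_deriv]
  refine ⟨fun y => (hasDerivAt_gaussCDF y).differentiableAt, by simp, ?_⟩
  have : deriv gaussCDF = fun z => Real.exp (-z ^ 2) / √Real.pi :=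
    funext fun y => (hasDerivAt_gaussCDF y).deriv
  rw [this]
  fun_prop

theorem strictMono_gaussCDF : StrictMono gaussCDF :=
  strictMono_of_hasDerivAt_pos hasDerivAt_gaussCDF fun z => by positivity

theorem gaussCDF_zero : gaussCDF 0 = 1 / 2 := by simp [gaussCDF]

theorem gaussCDF_neg (z : ℝ) : gaussCDF (-z) = 1 - gaussCDF z := by
  have h : ∫ s in (0 : ℝ)..(-z), Real.exp (-s ^ 2) = -∫ s in (0 : ℝ)..z, Real.exp (-s ^ 2) := by
    have := intervalIntegral.integral_comp_neg (a := 0) (b := z) fun s : ℝ => Real.exp (-s ^ 2)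
    simp only [neg_sq, neg_zero] at this
    rw [this, intervalIntegral.integral_symm]
  rw [gaussCDF, gaussCDF, h]
  ring

theorem tendsto_gaussCDF_atTop : Tendsto gaussCDF atTop (𝓝 1) := by
  have hi : Integrable fun s : ℝ => Real.exp (-s ^ 2) := by
    simpa using integrable_exp_neg_mul_sq (b := 1) one_pos
  have h1 := intervalIntegral_tendsto_integral_Ioi 0 hi.integrableOn tendsto_id
  have h2 : ∫ s in Ioi (0 : ℝ), Real.exp (-s ^ 2) = √Real.pi / 2 := by
    simpa using integral_gaussian_Ioi 1
  rw [h2] at h1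
  have h3 := (h1.div_const √Real.pi).const_add (1 / 2)
  have h4 : 1 / 2 + √Real.pi / 2 / √Real.pi = 1 := by
    have : √Real.pi ≠ 0 := (Real.sqrt_pos.2 Real.pi_pos).ne'
    field_simp
    norm_num
  rw [h4] at h3
  exact h3

theorem gaussCDF_le_one (z : ℝ) : gaussCDF z ≤ 1 :=
  strictMono_gaussCDF.monotone.ge_of_tendsto tendsto_gaussCDF_atTop z

theorem gaussCDF_nonneg (z : ℝ) : 0 ≤ gaussCDF z := by
  have := gaussCDF_neg (-z)
  rw [neg_neg] at this
  linarith [gaussCDF_le_one (-z)]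

theorem gaussCDF_sub_le {a b : ℝ} (h : a ≤ b) :
    gaussCDF b - gaussCDF a ≤ (b - a) / √Real.pi := by
  have : Monotone fun z => z / √Real.pi - gaussCDF z := by
    refine monotone_of_hasDerivAt_nonneg
      (fun z => ((hasDerivAt_id z).div_const _).sub (hasDerivAt_gaussCDF z)) fun z => ?_
    rw [Pi.zero_apply, ← sub_div]
    have : Real.exp (-z ^ 2) ≤ 1 := Real.exp_le_one_iff.2 (by nlinarith [sq_nonneg z])
    exact div_nonneg (by linarith) (Real.sqrt_nonneg _)
  have := this h
  simp only at this
  rw [sub_div]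
  linarith

/-- Replacing the exponential by 1 leaves 1 + N(y+q) - N(y-q), and N is Lipschitz with constant
1/√π. -/
theorem gaussCDF_combination_le {y q : ℝ} (hy : 0 ≤ y) (hq : 0 ≤ q) :
    gaussCDF (y + q) + Real.exp (-(4 * y * q)) * gaussCDF (q - y) ≤ 1 + 2 * q / √Real.pi := by
  have h1 : Real.exp (-(4 * y * q)) ≤ 1 := Real.exp_le_one_iff.2 (by
    have : 0 ≤ 4 * y * q := by positivity
    linarith)
  have h2 : Real.exp (-(4 * y * q)) * gaussCDF (q - y) ≤ gaussCDF (q - y) :=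
    mul_le_of_le_one_left (gaussCDF_nonneg _) h1
  have h3 : gaussCDF (q - y) = 1 - gaussCDF (y - q) := by rw [← gaussCDF_neg, neg_sub]
  have h4 := gaussCDF_sub_le (show y - q ≤ y + q by linarith)
  rw [show y + q - (y - q) = 2 * q by ring] at h4
  linarith

/-- In the y-derivative the two Gaussian densities cancel, since (y+q)² = 4yq + (q-y)². What remains
is nonpositive, so the combination decreases in y, and it is bounded below by N(y+q), which tends to
1. -/
theorem one_le_gaussCDF_combination (y : ℝ) {q : ℝ} (hq : 0 ≤ q) :
    1 ≤ gaussCDF (y + q) + Real.exp (-(4 * y * q)) * gaussCDF (q - y) := by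
  rcases hq.eq_or_lt with rfl | hq
  · have := gaussCDF_neg y
    simp [this]
  have hd : ∀ y, HasDerivAt
      (fun y => gaussCDF (y + q) + Real.exp (-(4 * y * q)) * gaussCDF (q - y))
      (-(4 * q) * Real.exp (-(4 * y * q)) * gaussCDF (q - y)) y := by
    intro y
    have h1 : HasDerivAt (fun y => gaussCDF (y + q)) _ y :=
      HasDerivAt.comp (h₂ := gaussCDF) (h := fun y => y + q) y (hasDerivAt_gaussCDF (y + q))
        ((hasDerivAt_id y).add_const q)
    have h2 : HasDerivAt (fun y => gaussCDF (q - y)) _ y :=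
      HasDerivAt.comp (h₂ := gaussCDF) (h := fun y => q - y) y (hasDerivAt_gaussCDF (q - y))
        ((hasDerivAt_id y).const_sub q)
    have h3 : HasDerivAt (fun y : ℝ => Real.exp (-(4 * y * q))) _ y :=
      ((((hasDerivAt_id y).const_mul 4).mul_const q).neg).exp
    refine ((h1.add (h3.mul h2)).congr_deriv ?_ :)
    have h4 : Real.exp (-(y + q) ^ 2) = Real.exp (-(4 * y * q)) * Real.exp (-(q - y) ^ 2) := by
      rw [← Real.exp_add]; ring_nf
    rw [h4]
    simp only [Pi.neg_apply, id]
    ring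
  have hanti : Antitone fun y => gaussCDF (y + q) + Real.exp (-(4 * y * q)) * gaussCDF (q - y) :=
    antitone_of_hasDerivAt_nonpos hd fun y => by
      have := gaussCDF_nonneg (q - y)
      have : 0 ≤ 4 * q * Real.exp (-(4 * y * q)) * gaussCDF (q - y) := by positivity
      simp only [Pi.zero_apply]
      linarith
  have hlim : Tendsto (fun y => gaussCDF (y + q)) atTop (𝓝 1) :=
    tendsto_gaussCDF_atTop.comp (tendsto_atTop_add_const_right _ q tendsto_id)
  refine le_of_tendsto hlim ((eventually_ge_atTop y).mono fun z hz => ?_)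
  refine le_trans ?_ (hanti hz)
  have := gaussCDF_nonneg (q - z)
  exact le_add_of_nonneg_right (by positivity)

/-! ### The explicit viscous solution -/

/-- The Hopf–Cole image of the viscous solution with initial value `-|x|`. -/
noncomputable def viscousPlane (ε a : ℝ) (z : ℝ × ℝ) : ℝ :=
  Real.exp ((a * z.1 / 2 + z.2 / 4) / ε) * gaussCDF ((a * z.1 + z.2) / (2 * √(ε * z.2)))

/-- The solution of `w_t = ε w_xx` with initial value `exp (|x| / (2 ε))`. -/
noncomputable def viscousProfile (ε : ℝ) (z : ℝ × ℝ) : ℝ :=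
  if z.2 ≤ 0 then Real.exp (|z.1| / 2 / ε) else viscousPlane ε 1 z + viscousPlane ε (-1) z

/-- For a = ±1 this function is the heat evolution of exp(ax/(2ε)) cut off to ax > 0: completing the
square shifts the Gaussian mean by at. -/
theorem heatAt_viscousPlane {ε a x t : ℝ} (hε : 0 < ε) (ha : a ^ 2 = 1) (ht : 0 < t) :
    HeatAt ε (viscousPlane ε a) x t := by
  set σ := √(ε * t) with hσ
  have hσ0 : 0 < σ := Real.sqrt_pos.2 (by positivity)
  have hσ2 : σ ^ 2 = ε * t := Real.sq_sqrt (by positivity)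
  set ζ : ℝ → ℝ := fun y => (a * y + t) / (2 * σ) with hζ
  set E : ℝ → ℝ := fun y => Real.exp ((a * y / 2 + t / 4) / ε) with hE
  have hζd : ∀ y, HasDerivAt ζ (a / (2 * σ)) y := fun y => by
    simpa using (((hasDerivAt_id y).const_mul a).add_const t).div_const (2 * σ)
  have hEd : ∀ y, HasDerivAt E (E y * (a / 2 / ε)) y := fun y => by
    have := ((((hasDerivAt_id y).const_mul a).div_const 2).add_const (t / 4)).div_const ε |>.exp
    simpa using this
  have hNd : ∀ y, HasDerivAt (fun y => gaussCDF (ζ y))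
      (Real.exp (-(ζ y) ^ 2) / √Real.pi * (a / (2 * σ))) y := fun y =>
    HasDerivAt.comp (h₂ := gaussCDF) (h := ζ) y (hasDerivAt_gaussCDF (ζ y)) (hζd y)
  have hGd : ∀ y, HasDerivAt (fun y => Real.exp (-(ζ y) ^ 2))
      (Real.exp (-(ζ y) ^ 2) * (-(2 * ζ y * (a / (2 * σ))))) y := fun y => by
    have := ((hζd y).pow 2).neg.exp
    simpa using this
  have hσd : HasDerivAt (fun s => √(ε * s)) (ε / (2 * σ)) t := by
    have := ((hasDerivAt_id t).const_mul ε).sqrt (mul_pos hε ht).ne'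
    simpa using this
  have htd : HasDerivAt (fun s => (a * x + s) / (2 * √(ε * s)))
      (1 / (2 * σ) - ζ x * ε / (2 * σ ^ 2)) t := by
    have h1 := ((hasDerivAt_id t).const_add (a * x)).div (hσd.const_mul 2) (by positivity)
    refine (h1.congr_deriv ?_ :)
    simp only [hζ, id, ← hσ]
    field_simp
  have hpi : √Real.pi ≠ 0 := (Real.sqrt_pos.2 Real.pi_pos).ne'
  refine HeatAt.of_hasDerivAt
    (τ := E x * (1 / 4 / ε) * gaussCDF (ζ x) + E x *
      (Real.exp (-(ζ x) ^ 2) / √Real.pi * (1 / (2 * σ) - ζ x * ε / (2 * σ ^ 2))))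
    (g := fun y => E y * (a / 2 / ε) * gaussCDF (ζ y)
      + E y * (Real.exp (-(ζ y) ^ 2) / √Real.pi * (a / (2 * σ))))
    ?_ ?_ ?_ ?_ ?_
    (X := (E x * (a / 2 / ε) * (a / 2 / ε) * gaussCDF (ζ x)
      + E x * (a / 2 / ε) * (Real.exp (-(ζ x) ^ 2) / √Real.pi * (a / (2 * σ))))
      + (E x * (a / 2 / ε) * (Real.exp (-(ζ x) ^ 2) / √Real.pi * (a / (2 * σ)))
      + E x * (Real.exp (-(ζ x) ^ 2) * (-(2 * ζ x * (a / (2 * σ)))) / √Real.pi * (a / (2 * σ)))))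
  · refine ContDiffAt.mul (by fun_prop) ?_
    refine contDiff_gaussCDF.contDiffAt.comp _ ?_
    refine ContDiffAt.div (by fun_prop) ?_ (by simp only; positivity)
    refine contDiffAt_const.mul (ContDiffAt.sqrt (by fun_prop) (by simp only; positivity))
  · have h1 : HasDerivAt (fun s => Real.exp ((a * x / 2 + s / 4) / ε)) (E x * (1 / 4 / ε)) t := by
      have := ((((hasDerivAt_id t).div_const 4).const_add (a * x / 2)).div_const ε).exp
      simpa using this
    have h2 : HasDerivAt (fun s => gaussCDF ((a * x + s) / (2 * √(ε * s)))) _ t :=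
      HasDerivAt.comp (h₂ := gaussCDF) (h := fun s => (a * x + s) / (2 * √(ε * s))) t
        (hasDerivAt_gaussCDF (ζ x)) htd
    exact h1.mul h2
  · exact Eventually.of_forall fun y => (hEd y).mul (hNd y)
  · exact (((hEd x).mul_const _).mul (hNd x)).add
      ((hEd x).mul (((hGd x).div_const _).mul_const _))
  · generalize Real.exp (-(ζ x) ^ 2) = g
    generalize gaussCDF (ζ x) = N
    generalize E x = e
    generalize ζ x = ξ
    rcases sq_eq_sq_iff_eq_or_eq_neg.1 (ha.trans (one_pow 2).symm) with rfl | rfl <;> field_simp <;> ring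

theorem viscousProfile_of_pos {ε x t : ℝ} (hε : 0 < ε) (ht : 0 < t) :
    viscousProfile ε (x, t) = Real.exp ((|x| / 2 + t / 4) / ε) *
      (gaussCDF (|x| / (2 * √(ε * t)) + √t / (2 * √ε))
        + Real.exp (-(4 * (|x| / (2 * √(ε * t))) * (√t / (2 * √ε))))
          * gaussCDF (√t / (2 * √ε) - |x| / (2 * √(ε * t)))) := by
  have hs : 0 < √t := Real.sqrt_pos.2 ht
  have he : 0 < √ε := Real.sqrt_pos.2 hε
  have hst : √t ^ 2 = t := Real.sq_sqrt ht.le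
  have hse : √ε ^ 2 = ε := Real.sq_sqrt hε.le
  have hq : √t / (2 * √ε) = t / (2 * √(ε * t)) := by
    rw [Real.sqrt_mul hε.le]
    field_simp
    linarith
  have hexp : Real.exp ((|x| / 2 + t / 4) / ε)
      * Real.exp (-(4 * (|x| / (2 * √(ε * t))) * (√t / (2 * √ε))))
      = Real.exp ((-|x| / 2 + t / 4) / ε) := by
    rw [← Real.exp_add, Real.sqrt_mul hε.le]
    congr 1
    have : 4 * (|x| / (2 * (√ε * √t))) * (√t / (2 * √ε)) = |x| / √ε ^ 2 := by
      field_simp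
      ring
    rw [this, hse]
    field_simp
    ring
  rw [mul_add, ← mul_assoc, hexp, hq, ← add_div, ← sub_div]
  have h0 : ¬ t ≤ 0 := ht.not_ge
  simp only [viscousProfile, viscousPlane, if_neg h0]
  rcases abs_cases x with ⟨h, -⟩ | ⟨h, -⟩ <;> rw [h]
  · rw [one_mul, neg_one_mul, neg_add_eq_sub]
  · rw [one_mul, neg_one_mul, neg_neg, sub_neg_eq_add, add_comm t x, add_comm]

theorem exp_le_viscousProfile {ε x t : ℝ} (hε : 0 < ε) (ht : 0 ≤ t) :
    Real.exp ((|x| / 2 + t / 4) / ε) ≤ viscousProfile ε (x, t) := by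
  rcases ht.eq_or_lt with rfl | ht
  · simp [viscousProfile]
  · rw [viscousProfile_of_pos hε ht]
    exact le_mul_of_one_le_right (Real.exp_pos _).le
      (one_le_gaussCDF_combination _ (by positivity))

theorem viscousProfile_le {ε x t : ℝ} (hε : 0 < ε) (ht : 0 ≤ t) :
    viscousProfile ε (x, t)
      ≤ Real.exp ((|x| / 2 + t / 4) / ε) * (1 + 2 * (√t / (2 * √ε)) / √Real.pi) := by
  rcases ht.eq_or_lt with rfl | ht
  · simp [viscousProfile]
  · rw [viscousProfile_of_pos hε ht]
    refine mul_le_mul_of_nonneg_left ?_ (Real.exp_pos _).le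
    exact gaussCDF_combination_le (by positivity) (by positivity)

theorem heatAt_viscousProfile {ε x t : ℝ} (hε : 0 < ε) (ht : 0 < t) :
    HeatAt ε (viscousProfile ε) x t := by
  have h := (heatAt_viscousPlane (x := x) hε (one_pow 2) ht).add
    (heatAt_viscousPlane (x := x) hε (by norm_num : (-1 : ℝ) ^ 2 = 1) ht)
  have heq : ∀ y, ∀ s > 0, viscousProfile ε (y, s)
      = viscousPlane ε 1 (y, s) + viscousPlane ε (-1) (y, s) := fun y s hs => by
    have h0 : ¬ s ≤ 0 := not_le.2 hs
    simp only [viscousProfile, if_neg h0]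
  refine ⟨h.1.congr_of_eventuallyEq ?_, ?_⟩
  · have : ∀ᶠ z : ℝ × ℝ in 𝓝 (x, t), 0 < z.2 := continuous_snd.continuousAt.eventually (lt_mem_nhds ht)
    filter_upwards [this] with z hz using heq z.1 z.2 hz
  · have e1 : (fun s => viscousProfile ε (x, s)) =ᶠ[𝓝 t]
        fun s => viscousPlane ε 1 (x, s) + viscousPlane ε (-1) (x, s) := by
      filter_upwards [lt_mem_nhds ht] with s hs using heq x s hs
    have e2 : (fun y => viscousProfile ε (y, t))
        = fun y => viscousPlane ε 1 (y, t) + viscousPlane ε (-1) (y, t) :=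
      funext fun y => heq y t ht
    rw [e1.deriv_eq, e2]
    exact h.2

theorem continuousOn_viscousProfile {ε : ℝ} (hε : 0 < ε) :
    ContinuousOn (viscousProfile ε) (univ ×ˢ Ici 0) := by
  rintro ⟨x, t⟩ ⟨-, ht⟩
  rcases (mem_Ici.1 ht).eq_or_lt with h | h
  · simp only at h
    subst h
    have hv : viscousProfile ε (x, 0) = Real.exp ((|x| / 2 + 0 / 4) / ε) := by
      simp [viscousProfile]
    have h1 : Continuous fun z : ℝ × ℝ => Real.exp ((|z.1| / 2 + z.2 / 4) / ε) := by fun_prop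
    have h2 : Continuous fun z : ℝ × ℝ => Real.exp ((|z.1| / 2 + z.2 / 4) / ε)
        * (1 + 2 * (√z.2 / (2 * √ε)) / √Real.pi) := by fun_prop
    have l1 := (h1.tendsto (x, 0)).mono_left (nhdsWithin_le_nhds (s := univ ×ˢ Ici 0))
    have l2 := (h2.tendsto (x, 0)).mono_left (nhdsWithin_le_nhds (s := univ ×ˢ Ici 0))
    simp only [Real.sqrt_zero, zero_div, mul_zero, add_zero, mul_one] at l1 l2
    rw [ContinuousWithinAt, hv]
    simp only [zero_div, add_zero]
    -- At t = 0 the two explicit bounds coincide and squeeze the profile.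
    refine tendsto_of_tendsto_of_tendsto_of_le_of_le' l1 l2 ?_ ?_
    · filter_upwards [self_mem_nhdsWithin] with z hz using exp_le_viscousProfile hε hz.2
    · filter_upwards [self_mem_nhdsWithin] with z hz using viscousProfile_le hε hz.2
  · exact (heatAt_viscousProfile hε h).1.continuousAt.continuousWithinAt

/-! ### Uniqueness for the viscous problem -/

theorem HeatAt.comp_neg {ε : ℝ} {ψ : ℝ × ℝ → ℝ} {x t : ℝ} (h : HeatAt ε ψ (-x) t) :
    HeatAt ε (fun z => ψ (-z.1, z.2)) x t := by
  refine ⟨ContDiffAt.comp (f := fun z : ℝ × ℝ => (-z.1, z.2)) (x, t) h.1 (by fun_prop), ?_⟩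
  have e : iteratedDeriv 2 (fun y => ψ (-y, t)) x = iteratedDeriv 2 (fun y => ψ (y, t)) (-x) := by
    have := iteratedDeriv_comp_neg 2 (fun y => ψ (y, t)) x
    simpa using this
  simp only
  rw [e, h.2]

theorem IsHeatSupersolution.comp_neg {ε : ℝ} {w : ℝ × ℝ → ℝ} (hw : IsHeatSupersolution ε w) :
    IsHeatSupersolution ε (fun z => w (-z.1, z.2)) := by
  intro ψ x t ht hψ hmin
  have hc : ContinuousAt (fun z : ℝ × ℝ => (-z.1, z.2)) (-x, t) := by fun_prop
  have h1 : ContDiffAt ℝ 2 (fun z : ℝ × ℝ => ψ (-z.1, z.2)) (-x, t) :=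
    ContDiffAt.comp (f := fun z : ℝ × ℝ => (-z.1, z.2)) (-x, t) (by simpa using hψ) (by fun_prop)
  have h2 : IsLocalMin (fun z : ℝ × ℝ => w z - ψ (-z.1, z.2)) (-x, t) := by
    have := hc.eventually (p := fun z => w (-x, t) - ψ (x, t) ≤ w (-z.1, z.2) - ψ z)
      (by simpa [IsLocalMin, IsMinFilter] using hmin)
    simpa [IsLocalMin, IsMinFilter] using this
  have h3 := hw _ (-x) t ht h1 h2
  have e : iteratedDeriv 2 (fun y => ψ (-y, t)) (-x) = iteratedDeriv 2 (fun y => ψ (y, t)) x := by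
    have := iteratedDeriv_comp_neg 2 (fun y => ψ (y, t)) (-x)
    simpa using this
  simpa [e] using h3

theorem heatAt_exp_mul_cosh {ε : ℝ} (hε : 0 < ε) (x t : ℝ) :
    HeatAt ε (fun z => Real.exp (z.2 / ε) * Real.cosh (z.1 / ε)) x t := by
  have hd : ∀ y, HasDerivAt (fun y : ℝ => y / ε) (1 / ε) y := fun y => (hasDerivAt_id y).div_const ε
  refine HeatAt.of_hasDerivAt (τ := Real.exp (t / ε) * (1 / ε) * Real.cosh (x / ε))
    (g := fun y => Real.exp (t / ε) * (Real.sinh (y / ε) * (1 / ε)))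
    (X := Real.exp (t / ε) * (Real.cosh (x / ε) * (1 / ε) * (1 / ε))) ?_ ?_ ?_ ?_ ?_
  · refine ContDiffAt.mul (by fun_prop) ?_
    exact Real.contDiff_cosh.contDiffAt.comp _ (by fun_prop)
  · exact (hd t).exp.mul_const (Real.cosh (x / ε))
  · exact Eventually.of_forall fun y => ((hd y).cosh).const_mul (Real.exp (t / ε))
  · exact (((hd x).sinh).mul_const _).const_mul _
  · field_simp

/-- The profile grows like e^{|x|/(2ε)}, so a small multiple of the caloric function e^{t/ε}
cosh(x/ε) dominates it on distant sides, where w ≥ 0 is then enough. -/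
theorem IsHeatSupersolution.viscousProfile_le {ε : ℝ} {w : ℝ × ℝ → ℝ} (hε : 0 < ε)
    (hw : IsHeatSupersolution ε w) (hwc : ContinuousOn w (univ ×ˢ Ici 0))
    (hpos : ∀ x t, 0 ≤ t → 0 ≤ w (x, t)) (h0 : ∀ x, w (x, 0) = Real.exp (|x| / 2 / ε))
    {x t : ℝ} (ht : 0 ≤ t) : viscousProfile ε (x, t) ≤ w (x, t) := by
  set B : ℝ × ℝ → ℝ := fun z => Real.exp (z.2 / ε) * Real.cosh (z.1 / ε) with hB
  have hBp : ∀ z, 0 < B z := fun z => mul_pos (Real.exp_pos _) (Real.cosh_pos _)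
  refine le_of_forall_pos_le_add fun μ' hμ' => ?_
  set μ := μ' / B (x, t) with hμ
  have hμp : 0 < μ := div_pos hμ' (hBp _)
  set T := t + 1 with hT
  set K := 1 + 2 * (√T / (2 * √ε)) / √Real.pi with hK
  have hlim : Tendsto (fun R : ℝ => μ * Real.exp (R / ε / 2)) atTop atTop :=
    ((Real.tendsto_exp_atTop.comp ((tendsto_id.atTop_div_const hε).atTop_div_const two_pos))).const_mul_atTop
      hμp
  obtain ⟨R, hRK, hRx⟩ := ((hlim.eventually_ge_atTop (2 * K)).and
    (eventually_ge_atTop |x|)).exists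
  have hR0 : 0 ≤ R := (abs_nonneg x).trans hRx
  have hψ : ∀ y, ∀ s > 0, HeatAt ε (fun z => viscousProfile ε z - μ * B z) y s := fun y s hs =>
    (heatAt_viscousProfile hε hs).sub ((heatAt_exp_mul_cosh hε y s).const_mul μ)
  have hside : ∀ y, |y| = R → ∀ s ∈ Icc 0 T, viscousProfile ε (y, s) - μ * B (y, s) ≤ w (y, s) := by
    intro y hy s hs
    have h1 := _root_.viscousProfile_le (x := y) hε hs.1
    have h2 : Real.exp ((|y| / 2 + s / 4) / ε) * (1 + 2 * (√s / (2 * √ε)) / √Real.pi)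
        ≤ (Real.exp (s / ε) * Real.exp (R / ε / 2)) * K := by
      rw [hy, ← Real.exp_add]
      have e1 : (R / 2 + s / 4) / ε ≤ s / ε + R / ε / 2 := by
        have : (R / 2 + s / 4) / ε = R / ε / 2 + s / ε / 4 := by field_simp
        have := div_nonneg hs.1 hε.le
        linarith
      have := Real.sqrt_le_sqrt hs.2
      gcongr
      rw [hK]
      gcongr
    have h3 : Real.exp (s / ε) * Real.exp (R / ε / 2) * K ≤ μ * B (y, s) := by
      have e1 : Real.cosh (y / ε) = Real.cosh (R / ε) := by
        rw [← Real.cosh_abs, abs_div, hy, abs_of_pos hε]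
      have e2 : Real.exp (R / ε) ≤ 2 * Real.cosh (R / ε) := by
        rw [Real.cosh_eq]; linarith [Real.exp_pos (-(R / ε))]
      have e3 : Real.exp (R / ε) = Real.exp (R / ε / 2) * Real.exp (R / ε / 2) := by
        rw [← Real.exp_add]; ring_nf
      have e4 : Real.exp (R / ε / 2) * K ≤ μ * Real.cosh (R / ε) := by
        have := mul_le_mul_of_nonneg_left hRK (Real.exp_pos (R / ε / 2)).le
        have := mul_le_mul_of_nonneg_left e2 hμp.le
        rw [e3] at this
        linarith
      simp only [hB, e1]
      have := mul_le_mul_of_nonneg_left e4 (Real.exp_pos (s / ε)).le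
      linarith
    linarith [hpos y s hs.1]
  have hψc : ContinuousOn (fun z => viscousProfile ε z - μ * B z) (Icc (-R) R ×ˢ Icc 0 T) :=
    ((continuousOn_viscousProfile hε).mono (prod_mono (subset_univ _) fun s hs => hs.1)).sub
      (by fun_prop)
  have := hw.comparison le_rfl hwc hψc (fun y _ s hs => hψ y s hs.1)
    (fun y _ => by
      have := hBp (y, 0)
      simp only [viscousProfile, le_refl, if_true, h0]
      nlinarith)
    (fun s hs => hside (-R) (by rw [abs_neg, abs_of_nonneg hR0]) s hs)
    (fun s hs => hside R (abs_of_nonneg hR0) s hs)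
    (x := x) (t := t) (abs_le.1 hRx) ⟨ht, by linarith⟩
  have e : μ * B (x, t) = μ' := div_mul_cancel₀ _ (hBp _).ne'
  linarith

/-- The lateral barriers for x = R and, by reflection, for x = -R are added to the profile. They
dominate w on the sides and are negligible at the given point. -/
theorem le_viscousProfile_of_isHeatSupersolution {ε : ℝ} {w : ℝ × ℝ → ℝ} (hε : 0 < ε)
    (hw : IsHeatSupersolution ε w) (hw' : IsHeatSupersolution ε fun z => -w z)
    (hwc : ContinuousOn w (univ ×ˢ Ici 0)) (hpos : ∀ x t, 0 ≤ t → 0 < w (x, t))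
    (h0 : ∀ x, w (x, 0) = Real.exp (|x| / 2 / ε))
    {x t : ℝ} (ht : 0 < t) : w (x, t) ≤ viscousProfile ε (x, t) := by
  obtain ⟨C₁, hC₁, C₂, hC₂, hbar⟩ := IsHeatSupersolution.exists_lateral_barrier ε hε
  refine le_of_forall_pos_le_add fun μ' hμ' => ?_
  set μ := μ' / 2 with hμ
  have hμp : 0 < μ := by positivity
  set t₁ := 2 * t with ht₁
  have ht₁p : 0 < t₁ := by positivity
  set v := w (0, 65 * t₁) with hv
  have hvp : 0 < v := hpos _ _ (by positivity)
  -- Chosen so that the two barriers together contribute at most μ at `(x, t)`.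
  set A := μ / (2 * C₁ * C₂ * v) with hA
  have hAp : 0 < A := by positivity
  have hwc' : ContinuousOn (fun z : ℝ × ℝ => w (-z.1, z.2)) (univ ×ˢ Ici 0) :=
    hwc.comp (by fun_prop) fun z hz => ⟨mem_univ _, hz.2⟩
  obtain ⟨R₁, hR₁⟩ := hbar w hw hwc hpos t₁ ht₁p A hAp x
  obtain ⟨R₂, hR₂⟩ := hbar _ hw.comp_neg hwc' (fun y s hs => hpos _ _ hs) t₁ ht₁p A hAp (-x)
  set R := max (max R₁ R₂) |x| with hR
  have hRx : |x| ≤ R := le_max_right _ _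
  have hWc : ∀ y : ℝ, ContinuousOn (fun s => viscousProfile ε (y, s) + μ) (Icc 0 t₁) := fun y =>
    ((continuousOn_viscousProfile hε).comp (by fun_prop)
      fun s hs => ⟨mem_univ _, hs.1⟩).add continuousOn_const
  have hW0 : ∀ y, w (y, 0) < viscousProfile ε (y, 0) + μ := fun y => by
    simp only [viscousProfile, le_refl, if_true, h0]
    linarith
  have hWn : ∀ y, ∀ s ∈ Icc 0 t₁, 0 ≤ viscousProfile ε (y, s) := fun y s hs =>
    (Real.exp_pos _).le.trans (exp_le_viscousProfile hε hs.1)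
  obtain ⟨p, hp, hpn, hpR, hpx⟩ := hR₁ R ((le_max_left _ _).trans (le_max_left _ _)) _ (hWc R)
    (hW0 R) fun s hs => by linarith [hWn R s hs]
  obtain ⟨p', hp', hpn', hpR', hpx'⟩ := hR₂ R ((le_max_right _ _).trans (le_max_left _ _)) _
    (hWc (-R)) (hW0 (-R)) fun s hs => by linarith [hWn (-R) s hs]
  set ψ : ℝ × ℝ → ℝ := fun z =>
    -(viscousProfile ε z + μ + C₁ * (p z + p' (-z.1, z.2))) with hψ
  have hheat : ∀ y ∈ Icc (-R) R, ∀ s, HeatAt ε (fun z => C₁ * (p z + p' (-z.1, z.2))) y s :=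
    fun y hy s => ((hp y hy.2 s).add (HeatAt.comp_neg (hp' (-y) (by linarith [hy.1]) s))).const_mul _
  have hψc : ContinuousOn ψ (Icc (-R) R ×ˢ Icc 0 t₁) := by
    refine ((((continuousOn_viscousProfile hε).mono
      (prod_mono (subset_univ _) fun s hs => hs.1)).add continuousOn_const).add ?_).neg
    exact fun z hz => (hheat z.1 hz.1 z.2).1.continuousAt.continuousWithinAt
  have hcmp := hw'.comparison le_rfl hwc.neg hψc
    (fun y hy s hs => (((heatAt_viscousProfile hε hs.1).add (HeatAt.const ε μ y s)).add
      (hheat y (Ioo_subset_Icc_self hy) s)).neg) ?_ ?_ ?_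
    (x := x) (t := t) (abs_le.1 hRx) ⟨ht.le, by linarith⟩
  · have h1 := hpx t (by linarith)
    have h2 := hpx' t (by linarith)
    simp only [hψ] at hcmp
    rw [neg_zero] at h2
    have h3 : C₁ * (p (x, t) + p' (-x, t)) ≤ C₁ * (A * (C₂ * v) + A * (C₂ * v)) := by gcongr
    have h4 : C₁ * (A * (C₂ * v) + A * (C₂ * v)) = μ := by rw [hA]; field_simp; ring
    linarith
  · intro y _
    have h1 := hpn (y, 0)
    have h2 := hpn' (-y, 0)
    have h3 : 0 ≤ C₁ * (p (y, 0) + p' (-y, 0)) := by positivity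
    simp only [hψ]
    linarith [hW0 y]
  · intro s hs
    have h1 := hpn (-R, s)
    have h2 := hpR' s hs
    have h3 : 0 ≤ C₁ * p (-R, s) := by positivity
    simp only [hψ, neg_neg]
    linarith
  · intro s hs
    have h1 := hpn' (-R, s)
    have h2 := hpR s hs
    have h3 : 0 ≤ C₁ * p' (-R, s) := by positivity
    simp only [hψ]
    linarith

theorem IsViscositySolution.exp_eq_viscousProfile {ε : ℝ} {u : ℝ × ℝ → ℝ} (hε : 0 < ε)
    (hu : IsViscositySolution (fun p => p ^ 2 / 2) ε (fun x => -|x|) u) {x t : ℝ} (ht : 0 ≤ t) :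
    Real.exp (-u (x, t) / (2 * ε)) = viscousProfile ε (x, t) := by
  have h0 : ∀ x, Real.exp (-u (x, 0) / (2 * ε)) = Real.exp (|x| / 2 / ε) := fun x => by
    rw [hu.initial x, neg_neg, div_div]
  rcases ht.eq_or_lt with rfl | ht
  · rw [h0]
    simp [viscousProfile]
  · have hc : ContinuousOn (fun z => Real.exp (-u z / (2 * ε))) (univ ×ˢ Ici 0) :=
      (hu.continuousOn.neg.div_const _).rexp
    exact le_antisymm
      (le_viscousProfile_of_isHeatSupersolution hε (hu.subsolution.hopfCole hε)
        (hu.supersolution.hopfCole hε) hc (fun _ _ _ => Real.exp_pos _) h0 ht)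
      ((hu.subsolution.hopfCole hε).viscousProfile_le hε hc (fun _ _ _ => (Real.exp_pos _).le) h0
        ht.le)

/-! ### Comparison for the inviscid equation -/

theorem IsViscositySubsolution.le_of_firstOrder {u ψ : ℝ × ℝ → ℝ} {a b t₀ t₁ : ℝ}
    (hu : IsViscositySubsolution (fun p => p ^ 2 / 2) 0 u) (h0 : 0 ≤ t₀)
    (huc : ContinuousOn u (univ ×ˢ Ici 0)) (hψc : ContinuousOn ψ (Icc a b ×ˢ Icc t₀ t₁))
    (hψ : ∀ x ∈ Ioo a b, ∀ t ∈ Ioo t₀ t₁, ContDiffAt ℝ 2 ψ (x, t) ∧ ∃ τ p,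
      HasDerivAt (fun s => ψ (x, s)) τ t ∧ HasDerivAt (fun y => ψ (y, t)) p x ∧ 0 ≤ τ + p ^ 2 / 2)
    (hbot : ∀ x ∈ Icc a b, u (x, t₀) ≤ ψ (x, t₀))
    (hl : ∀ t ∈ Icc t₀ t₁, u (a, t) ≤ ψ (a, t))
    (hr : ∀ t ∈ Icc t₀ t₁, u (b, t) ≤ ψ (b, t))
    {x t : ℝ} (hx : x ∈ Icc a b) (ht : t ∈ Ico t₀ t₁) : u (x, t) ≤ ψ (x, t) := by
  by_contra! hlt
  have hc : ContinuousOn (fun z => (fun z => -u z) z - (fun z => -ψ z) z)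
      (Icc a b ×ˢ Icc t₀ t₁) :=
    (huc.mono (prod_mono (subset_univ _) fun s hs => h0.trans hs.1)).neg.sub hψc.neg
  obtain ⟨κ, hκ, y, hy, s, hs, hmin⟩ := exists_isLocalMin_of_lt hc
    (fun x hx => neg_le_neg (hbot x hx)) (fun t ht => neg_le_neg (hl t ht))
    (fun t ht => neg_le_neg (hr t ht)) hx ht (neg_lt_neg hlt)
  obtain ⟨hcd, τ, p, hτ, hp, hpde⟩ := hψ y hy s hs
  have hcd' : ContDiffAt ℝ 2 (fun z : ℝ × ℝ => ψ z - (-κ) / (t₁ - z.2)) (y, s) :=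
    contDiffAt_sub_const_div hcd hs.2
  have hmax : IsLocalMax (fun z : ℝ × ℝ => u z - (ψ z - (-κ) / (t₁ - z.2))) (y, s) := by
    filter_upwards [hmin] with z hz
    rw [neg_div, neg_div]
    linarith
  have := hu _ y s (h0.trans_lt hs.1) hcd' hmax
  have e1 := (hτ.sub (hasDerivAt_const_div_sub (κ := -κ) hs.2)).deriv
  have e2 := (hp.sub_const (-κ / (t₁ - s))).deriv
  simp only at this
  have e1' : deriv (fun r => ψ (y, r) - -κ / (t₁ - r)) s = τ - -κ / (t₁ - s) ^ 2 := e1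
  rw [e1', e2, zero_mul] at this
  have h2 : 0 < κ / (t₁ - s) ^ 2 := div_pos hκ (pow_pos (by linarith [hs.2]) 2)
  rw [neg_div] at this
  linarith

theorem IsViscositySupersolution.le_of_firstOrder {u ψ : ℝ × ℝ → ℝ} {a b t₀ t₁ : ℝ}
    (hu : IsViscositySupersolution (fun p => p ^ 2 / 2) 0 u) (h0 : 0 ≤ t₀)
    (huc : ContinuousOn u (univ ×ˢ Ici 0)) (hψc : ContinuousOn ψ (Icc a b ×ˢ Icc t₀ t₁))
    (hψ : ∀ x ∈ Ioo a b, ∀ t ∈ Ioo t₀ t₁, ContDiffAt ℝ 2 ψ (x, t) ∧ ∃ τ p,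
      HasDerivAt (fun s => ψ (x, s)) τ t ∧ HasDerivAt (fun y => ψ (y, t)) p x ∧ τ + p ^ 2 / 2 ≤ 0)
    (hbot : ∀ x ∈ Icc a b, ψ (x, t₀) ≤ u (x, t₀))
    (hl : ∀ t ∈ Icc t₀ t₁, ψ (a, t) ≤ u (a, t))
    (hr : ∀ t ∈ Icc t₀ t₁, ψ (b, t) ≤ u (b, t))
    {x t : ℝ} (hx : x ∈ Icc a b) (ht : t ∈ Ico t₀ t₁) : ψ (x, t) ≤ u (x, t) := by
  by_contra! hlt
  have hc : ContinuousOn (fun z => u z - ψ z) (Icc a b ×ˢ Icc t₀ t₁) :=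
    (huc.mono (prod_mono (subset_univ _) fun s hs => h0.trans hs.1)).sub hψc
  obtain ⟨κ, hκ, y, hy, s, hs, hmin⟩ := exists_isLocalMin_of_lt hc hbot hl hr hx ht hlt
  obtain ⟨hcd, τ, p, hτ, hp, hpde⟩ := hψ y hy s hs
  have := hu _ y s (h0.trans_lt hs.1) (contDiffAt_sub_const_div hcd hs.2) hmin
  have e1 := (hτ.sub (hasDerivAt_const_div_sub (κ := κ) hs.2)).deriv
  have e2 := (hp.sub_const (κ / (t₁ - s))).deriv
  simp only at this
  have e1' : deriv (fun r => ψ (y, r) - κ / (t₁ - r)) s = τ - κ / (t₁ - s) ^ 2 := e1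
  rw [e1', e2, zero_mul] at this
  have h2 : 0 < κ / (t₁ - s) ^ 2 := div_pos hκ (pow_pos (by linarith [hs.2]) 2)
  linarith

/-! ### Uniqueness for the inviscid problem -/

theorem hasDerivAt_sqrt_sq_add_sq {δ : ℝ} (hδ : 0 < δ) (x : ℝ) :
    ∃ p, HasDerivAt (fun y => √(δ ^ 2 + y ^ 2)) p x ∧ |p| ≤ 1 := by
  have hpos : 0 < δ ^ 2 + x ^ 2 := by positivity
  have h := (((hasDerivAt_id x).pow 2).const_add (δ ^ 2)).sqrt hpos.ne'
  refine ⟨_, h, ?_⟩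
  have h1 : |x| ≤ √(δ ^ 2 + x ^ 2) := Real.abs_le_sqrt (by nlinarith)
  have h2 : 0 < √(δ ^ 2 + x ^ 2) := Real.sqrt_pos.2 hpos
  simp only [id, Pi.pow_apply]
  rw [abs_div, abs_of_pos (by positivity : (0 : ℝ) < 2 * √(δ ^ 2 + x ^ 2)),
    div_le_one (by positivity)]
  norm_num [abs_mul]
  exact h1

theorem contDiff_sqrt_sq_add_sq {δ : ℝ} (hδ : 0 < δ) :
    ContDiff ℝ 2 fun z : ℝ × ℝ => √(δ ^ 2 + z.1 ^ 2) := by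
  refine ContDiff.sqrt (by fun_prop) fun z => ?_
  positivity

section Inviscid

variable {u : ℝ × ℝ → ℝ}

/-- A time-independent function is a classical supersolution, so a steep parabola at x₀ on a box of
width 2 is an upper barrier and no information at infinity is needed. -/
theorem IsViscositySolution.le_neg_abs
    (hu : IsViscositySolution (fun p => p ^ 2 / 2) 0 (fun x => -|x|) u) {x₀ t : ℝ} (ht : 0 ≤ t) :
    u (x₀, t) ≤ -|x₀| := by
  refine le_of_forall_pos_le_add fun μ hμ => ?_
  have hK : IsCompact (Icc (x₀ - 1) (x₀ + 1) ×ˢ Icc 0 (t + 1)) := isCompact_Icc.prod isCompact_Icc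
  obtain ⟨M, hM⟩ := hK.exists_bound_of_continuousOn
    (hu.continuousOn.mono (prod_mono (subset_univ _) fun s hs => hs.1))
  have hM' : ∀ x ∈ Icc (x₀ - 1) (x₀ + 1), ∀ s ∈ Icc 0 (t + 1), u (x, s) ≤ M := fun x hx s hs =>
    (le_abs_self _).trans (hM (x, s) ⟨hx, hs⟩)
  -- The first bound gives |x - x₀| ≤ μ + A(x - x₀)² at time 0; the second covers the sides, where
  -- (x - x₀)² = 1.
  set A := max (1 / (4 * μ)) (M + |x₀|) with hA
  have hA1 : 1 / (4 * μ) ≤ A := le_max_left _ _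
  have hA2 : M + |x₀| ≤ A := le_max_right _ _
  have hcd : ContDiff ℝ 2 fun z : ℝ × ℝ => -|x₀| + μ + A * (z.1 - x₀) ^ 2 := by fun_prop
  have := hu.subsolution.le_of_firstOrder (a := x₀ - 1) (b := x₀ + 1) (t₁ := t + 1) le_rfl
    hu.continuousOn hcd.continuous.continuousOn (fun x _ s _ => ⟨hcd.contDiffAt, 0, _,
      hasDerivAt_const s (-|x₀| + μ + A * (x - x₀) ^ 2),
      ((((hasDerivAt_id x).sub_const x₀).pow 2).const_mul A).const_add _, by positivity⟩)
    ?_ ?_ ?_ (x := x₀) (t := t) ⟨by linarith, by linarith⟩ ⟨ht, by linarith⟩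
  · simpa using this
  · intro x _
    rw [hu.initial]
    have h1 : |x₀| ≤ |x| + |x - x₀| := by
      have := abs_sub_abs_le_abs_sub x₀ x
      rw [abs_sub_comm] at this
      linarith
    have h2 : 1 ≤ 4 * μ * A := by
      rw [div_le_iff₀ (by positivity)] at hA1
      linarith
    have h3 : |x - x₀| ≤ μ + A * |x - x₀| ^ 2 := by
      have : 0 ≤ A := le_trans (by positivity) hA1
      nlinarith [sq_nonneg (|x - x₀| - 2 * μ), sq_nonneg (|x - x₀|),
        mul_nonneg this (sq_nonneg (|x - x₀|))]
    rw [sq_abs] at h3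
    linarith
  · intro s hs
    have := hM' (x₀ - 1) ⟨le_rfl, by linarith⟩ s hs
    simp only [sub_sub_cancel_left]
    linarith
  · intro s hs
    have := hM' (x₀ + 1) ⟨by linarith, le_rfl⟩ s hs
    simp only [add_sub_cancel_left]
    linarith

/-- The plane ax - t/2 is an exact solution. The correction κ(√(1+x²) + 2t) keeps it a
supersolution, since its time slope 2κ outweighs the cross term aκp ≥ -κ, and on distant sides it
compensates the loss s/2 in `IsViscositySolution.le_neg_abs`. -/
theorem IsViscositySolution.le_plane
    (hu : IsViscositySolution (fun p => p ^ 2 / 2) 0 (fun x => -|x|) u) {a x t : ℝ}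
    (ha : |a| = 1) (ht : 0 ≤ t) : u (x, t) ≤ a * x - t / 2 := by
  refine le_of_forall_pos_le_add fun μ hμ => ?_
  set κ := μ / (√(1 ^ 2 + x ^ 2) + 2 * t) with hκ
  have hden : 0 < √(1 ^ 2 + x ^ 2) + 2 * t := by positivity
  have hκp : 0 < κ := by positivity
  set L := max |x| ((t + 1) / (2 * κ)) with hL
  have hL1 : t + 1 ≤ 2 * κ * L := by
    have : (t + 1) / (2 * κ) ≤ L := le_max_right _ _
    rw [div_le_iff₀ (by positivity)] at this
    linarith
  have hL0 : 0 ≤ L := (abs_nonneg x).trans (le_max_left _ _)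
  have ha2 : a ^ 2 = 1 := by rw [← sq_abs, ha, one_pow]
  have hlin : ∀ y, -|y| ≤ a * y := fun y => by
    have := neg_abs_le (a * y)
    rwa [abs_mul, ha, one_mul] at this
  have hside : ∀ y, |y| = L → ∀ s ∈ Icc 0 (t + 1),
      u (y, s) ≤ a * y - s / 2 + κ * (√(1 ^ 2 + y ^ 2) + 2 * s) := by
    intro y hy s hs
    have h1 := hu.le_neg_abs (x₀ := y) hs.1
    have h2 : |y| ≤ √(1 ^ 2 + y ^ 2) := Real.abs_le_sqrt (by nlinarith)
    have h3 := mul_le_mul_of_nonneg_left h2 hκp.le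
    rw [hy] at h3
    have h4 := hlin y
    have h5 := mul_nonneg hκp.le hs.1
    have h6 := hs.2
    rw [mul_add]
    generalize κ * √(1 ^ 2 + y ^ 2) = S at h3 ⊢
    linarith
  have hcd : ContDiff ℝ 2 fun z : ℝ × ℝ =>
      a * z.1 - z.2 / 2 + κ * (√(1 ^ 2 + z.1 ^ 2) + 2 * z.2) :=
    ContDiff.add (by fun_prop)
      (contDiff_const.mul ((contDiff_sqrt_sq_add_sq one_pos).add (by fun_prop)))
  have := hu.subsolution.le_of_firstOrder (a := -L) (b := L) (t₁ := t + 1) le_rfl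
    hu.continuousOn hcd.continuous.continuousOn (fun y _ s _ => ?_)
    ?_ (hside (-L) (by rw [abs_neg, abs_of_nonneg hL0])) (hside L (abs_of_nonneg hL0))
    (x := x) (t := t) (abs_le.1 (le_max_left _ _)) ⟨ht, by linarith⟩
  · have e : κ * (√(1 ^ 2 + x ^ 2) + 2 * t) = μ := div_mul_cancel₀ _ hden.ne'
    simp only [e] at this
    exact this
  · obtain ⟨p, hp, hp1⟩ := hasDerivAt_sqrt_sq_add_sq one_pos y
    refine ⟨hcd.contDiffAt, -1 / 2 + κ * 2, a + κ * p, ?_, ?_, ?_⟩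
    · have := (((hasDerivAt_id s).div_const 2).const_sub (a * y)).add
        ((((hasDerivAt_id s).const_mul 2).const_add (√(1 ^ 2 + y ^ 2))).const_mul κ)
      refine (this.congr_deriv ?_ :)
      ring
    · have := (((hasDerivAt_id y).const_mul a).sub_const (s / 2)).add
        ((hp.add_const (2 * s)).const_mul κ)
      refine (this.congr_deriv ?_ :)
      ring
    · have h1 : -1 ≤ a * p := by
        have := neg_abs_le (a * p)
        rw [abs_mul, ha, one_mul] at this
        linarith
      nlinarith [sq_nonneg (κ * p), mul_le_mul_of_nonneg_left h1 hκp.le]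
  · intro y _
    rw [hu.initial]
    have : 0 ≤ κ * (√(1 ^ 2 + y ^ 2) + 2 * 0) := by positivity
    have h1 := hlin y
    simp only
    generalize κ * (√(1 ^ 2 + y ^ 2) + 2 * 0) = S at this ⊢
    linarith

theorem IsViscositySolution.inviscid_le
    (hu : IsViscositySolution (fun p => p ^ 2 / 2) 0 (fun x => -|x|) u) {x t : ℝ} (ht : 0 ≤ t) :
    u (x, t) ≤ -|x| - t / 2 := by
  have h1 := hu.le_plane (a := 1) (x := x) (by simp) ht
  have h2 := hu.le_plane (a := -1) (x := x) (by simp) ht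
  rcases abs_cases x with ⟨h, -⟩ | ⟨h, -⟩ <;> rw [h] <;> linarith

/-- A subsolution propagates lower bounds backwards in time along straight lines. -/
theorem IsViscositySolution.sub_le_of_lt
    (hu : IsViscositySolution (fun p => p ^ 2 / 2) 0 (fun x => -|x|) u) {x₀ s T : ℝ} (hs : 0 ≤ s)
    (hsT : s < T) : u (0, T) - 1 - x₀ ^ 2 / (2 * (T - s)) ≤ u (x₀, s) := by
  have hneg : ∀ x t, 0 ≤ t → u (x, t) ≤ 0 := fun x t ht =>
    (hu.le_neg_abs ht).trans (by simp)
  have hcs : Continuous fun x : ℝ => u (x, s) := by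
    refine hu.continuousOn.comp_continuous (by fun_prop) fun x => ⟨mem_univ _, hs⟩
  set m := u (x₀, s) with hm
  have hm0 : m ≤ 0 := hneg _ _ hs
  obtain ⟨r, hr, hr'⟩ := Metric.continuousAt_iff.1 (hcs.continuousAt (x := x₀)) 1 one_pos
  -- The barrier is a Hopf–Lax parabola issued slightly before time s. At time s it must already
  -- exceed 1 - m where |x - x₀| ≥ r, since only u ≤ 0 is known there; nearer x₀, continuity and the
  -- slack 1 suffice.
  set θ := min 1 (r ^ 2 / (2 * (1 - m))) with hθ
  have hm1 : 0 < 1 - m := by linarith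
  have hθp : 0 < θ := lt_min one_pos (by positivity)
  have hθr : 2 * θ * (1 - m) ≤ r ^ 2 := by
    have : θ ≤ r ^ 2 / (2 * (1 - m)) := min_le_right _ _
    rw [le_div_iff₀ (by positivity)] at this
    linarith
  set D := 2 * (T + 1 - s + θ) with hD
  have hDp : 0 < D := by linarith
  set L := max |x₀| (max 1 (D * (1 - m))) with hL
  have hL0 : |x₀| ≤ L := le_max_left _ _
  have hL1 : 1 ≤ L := (le_max_left _ _).trans (le_max_right _ _)
  have hL2 : D * (1 - m) ≤ L ^ 2 := by
    have : D * (1 - m) ≤ L := (le_max_right _ _).trans (le_max_right _ _)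
    nlinarith
  set ψ : ℝ × ℝ → ℝ := fun z => m + 1 + (z.1 - x₀) ^ 2 / (2 * (z.2 - s + θ)) with hψ
  have hcd : ∀ x, ∀ t ≥ s, ContDiffAt ℝ 2 ψ (x, t) := fun x t ht => by
    refine ContDiffAt.add contDiffAt_const (ContDiffAt.div (by fun_prop) (by fun_prop) ?_)
    have : 0 < t - s + θ := by linarith
    simp only
    positivity
  have hside : ∀ y, (y - x₀) ^ 2 = L ^ 2 → ∀ t ∈ Icc s (T + 1), u (y, t) ≤ ψ (y, t) := by
    intro y hy t ht
    refine (hneg y t (hs.trans ht.1)).trans ?_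
    simp only [hψ, hy]
    have h1 : L ^ 2 / D ≤ L ^ 2 / (2 * (t - s + θ)) := by
      have : 0 < t - s + θ := by linarith [ht.1]
      gcongr
      linarith [ht.2]
    have h2 : 1 - m ≤ L ^ 2 / D := by
      rw [le_div_iff₀ hDp]
      linarith
    linarith
  have := hu.subsolution.le_of_firstOrder (a := x₀ - L) (b := x₀ + L) (t₀ := s) (t₁ := T + 1) hs
    hu.continuousOn (ψ := ψ) (fun z hz => (hcd z.1 z.2 hz.2.1).continuousAt.continuousWithinAt)
    (fun x _ t ht => ?_)
    ?_ (hside (x₀ - L) (by ring)) (hside (x₀ + L) (by ring))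
    (x := 0) (t := T) ⟨by linarith [le_abs_self x₀], by linarith [neg_abs_le x₀]⟩
    ⟨hsT.le, by linarith⟩
  · have h1 : (0 - x₀) ^ 2 / (2 * (T - s + θ)) ≤ x₀ ^ 2 / (2 * (T - s)) := by
      have : 0 < T - s := by linarith
      rw [zero_sub, neg_sq]
      gcongr
      linarith
    simp only [hψ] at this
    linarith
  · have hτ : t - s + θ ≠ 0 := by linarith [ht.1]
    refine ⟨hcd x t ht.1.le, -(x - x₀) ^ 2 / (2 * (t - s + θ) ^ 2), (x - x₀) / (t - s + θ),
      ?_, ?_, ?_⟩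
    · have := ((hasDerivAt_const t ((x - x₀) ^ 2)).div
        ((((hasDerivAt_id t).sub_const s).add_const θ).const_mul 2) (by simpa using hτ)).const_add
        (m + 1)
      refine (this.congr_deriv ?_ :)
      simp only [id]
      field_simp
      ring
    · have := ((((hasDerivAt_id x).sub_const x₀).pow 2).div_const (2 * (t - s + θ))).const_add
        (m + 1)
      refine (this.congr_deriv ?_ :)
      simp only [id]
      field_simp
      norm_num [mul_comm]
    · refine le_of_eq ?_
      field_simp
      ring
  · intro x _
    simp only [hψ, sub_self, zero_add]
    rcases lt_or_ge |x - x₀| r with h | h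
    · have h1 := hr' (show dist x x₀ < r by rwa [Real.dist_eq])
      rw [Real.dist_eq] at h1
      have h2 := (abs_lt.1 h1).2
      have h3 : 0 ≤ (x - x₀) ^ 2 / (2 * θ) := by positivity
      linarith
    · refine (hneg x s hs).trans ?_
      have h1 : r ^ 2 ≤ (x - x₀) ^ 2 := by
        rw [← sq_abs (x - x₀)]
        gcongr
      have h2 : 1 - m ≤ (x - x₀) ^ 2 / (2 * θ) := by
        rw [le_div_iff₀ (by positivity)]
        linarith
      linarith

/-- The time slope κλy⁴ of the quartic term pays for the error in the squared gradient. Half absorbs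
32κ²r⁶, because κr² ≤ 2α and λ = 128α; the other half absorbs 8κr³ once r ≥ 16/λ, and μ covers
smaller r. -/
theorem quartic_barrier_ineq {κ α L lam lt μ y p : ℝ} (hα : 0 < α) (hκ : κ = 2 * α / L ^ 2)
    (hL : 0 < L) (hlam : lam = 128 * α) (hlt0 : 0 ≤ lt) (hlt : lt ≤ 1) (hy : |y| ≤ L)
    (hμ : κ * (8 * (16 / lam) ^ 3) ≤ μ) (hp : |p| ≤ 1) :
    -1 / 2 - μ - κ * (lam * y ^ 4) + (-p - κ * (4 * y ^ 3 * (1 + lt))) ^ 2 / 2 ≤ 0 := by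
  have hκp : 0 < κ := by rw [hκ]; positivity
  have hlamp : 0 < lam := by rw [hlam]; positivity
  set r := |y| with hr
  have hr0 : 0 ≤ r := abs_nonneg y
  have hy4 : y ^ 4 = r ^ 4 := by rw [hr]; exact (Even.pow_abs (by decide) y).symm
  have hb : |-p - κ * (4 * y ^ 3 * (1 + lt))| ≤ 1 + 8 * κ * r ^ 3 := by
    have h1 : |κ * (4 * y ^ 3 * (1 + lt))| ≤ 8 * κ * r ^ 3 := by
      rw [abs_mul, abs_mul, abs_mul, abs_pow, abs_of_pos hκp, abs_of_nonneg (by linarith : 0 ≤ 1 + lt),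
        ← hr, abs_of_pos (by norm_num : (0 : ℝ) < 4)]
      have : 0 ≤ κ * r ^ 3 := by positivity
      nlinarith
    calc _ ≤ |-p| + |κ * (4 * y ^ 3 * (1 + lt))| := abs_sub _ _
      _ ≤ _ := by rw [abs_neg]; linarith
  have hsq : (-p - κ * (4 * y ^ 3 * (1 + lt))) ^ 2 ≤ (1 + 8 * κ * r ^ 3) ^ 2 := by
    rw [← sq_abs]
    gcongr
  have h6 : 32 * κ ^ 2 * r ^ 6 ≤ κ * (lam / 2 * r ^ 4) := by
    have h1 : κ * r ^ 2 ≤ 2 * α := by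
      rw [hκ, div_mul_eq_mul_div, div_le_iff₀ (by positivity)]
      gcongr
    have h2 : 0 ≤ 32 * κ * r ^ 4 := by positivity
    have := mul_le_mul_of_nonneg_left h1 h2
    rw [hlam]
    linarith
  have h3 : 8 * r ^ 3 ≤ lam / 2 * r ^ 4 + 8 * (16 / lam) ^ 3 := by
    rcases le_total r (16 / lam) with h | h
    · have h1 : r ^ 3 ≤ (16 / lam) ^ 3 := by gcongr
      have h2 : 0 ≤ lam / 2 * r ^ 4 := by positivity
      linarith
    · rw [div_le_iff₀ hlamp] at h
      have h1 : 0 ≤ (16 / lam) ^ 3 := by positivity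
      have h2 : 0 ≤ r ^ 3 := by positivity
      have := mul_le_mul_of_nonneg_left h h2
      linarith
  have h4 := mul_le_mul_of_nonneg_left h3 hκp.le
  rw [hy4]
  nlinarith

theorem IsViscositySolution.le_inviscid
    (hu : IsViscositySolution (fun p => p ^ 2 / 2) 0 (fun x => -|x|) u) {x t : ℝ} (ht : 0 < t) :
    -|x| - t / 2 ≤ u (x, t) := by
  refine le_of_forall_pos_le_add fun μ' hμ' => ?_
  set μ := μ' / (2 + t) with hμ
  have hμp : 0 < μ := by positivity
  set t₁ := 2 * t with ht₁
  have ht₁p : 0 < t₁ := by positivity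
  -- This is the coefficient 1/(2 · 64t₁) of the Hopf–Lax bound from time 65t₁. It makes λt₁ = 1, so
  -- that 1 + λs ≤ 2 on [0, t₁].
  set α := 1 / (128 * t₁) with hα
  have hαp : 0 < α := by positivity
  set lam := 128 * α with hlam
  have hlam' : lam * t₁ = 1 := by rw [hlam, hα]; field_simp
  set B := |u (0, 65 * t₁)| + 1 with hB
  have hlow : ∀ y, ∀ s ∈ Icc 0 t₁, -B - α * y ^ 2 ≤ u (y, s) := by
    intro y s hs
    have h1 := hu.sub_le_of_lt (x₀ := y) (T := 65 * t₁) hs.1 (by linarith [hs.2])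
    have h2 : y ^ 2 / (2 * (65 * t₁ - s)) ≤ y ^ 2 / (2 * (64 * t₁)) := by
      gcongr
      linarith [hs.2]
    have h3 : y ^ 2 / (2 * (64 * t₁)) = α * y ^ 2 := by rw [hα]; field_simp; ring
    linarith [neg_abs_le (u (0, 65 * t₁))]
  have hlim : Tendsto (fun L : ℝ => 2 * α / L ^ 2) atTop (𝓝 0) :=
    (tendsto_pow_atTop two_ne_zero).const_div_atTop _
  have hlim1 := hlim.mul_const (8 * (16 / lam) ^ 3)
  have hlim2 := hlim.mul_const (2 * x ^ 4)
  rw [zero_mul] at hlim1 hlim2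
  have hlim3 : Tendsto (fun L : ℝ => α * L ^ 2) atTop atTop :=
    (tendsto_pow_atTop two_ne_zero).const_mul_atTop hαp
  obtain ⟨L, ⟨hL1, hL2⟩, hL3, hLx, hL0⟩ := (((hlim1.eventually (gt_mem_nhds hμp)).and
    (hlim2.eventually (gt_mem_nhds hμp))).and ((hlim3.eventually_ge_atTop B).and
    ((eventually_ge_atTop |x|).and (eventually_gt_atTop 0)))).exists
  -- At |x| = L the quartic term is at least 2αL² ≥ αL² + B, beating the quadratic lower bound for
  -- u, while at a fixed point it vanishes as L grows.
  set κ := 2 * α / L ^ 2 with hκ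
  have hκp : 0 < κ := by positivity
  have hκL : κ * L ^ 4 = 2 * (α * L ^ 2) := by rw [hκ]; field_simp
  set ψ : ℝ × ℝ → ℝ := fun z =>
    -√(μ ^ 2 + z.1 ^ 2) - z.2 / 2 - μ * z.2 - κ * (z.1 ^ 4 * (1 + lam * z.2)) with hψ
  have hcd : ContDiff ℝ 2 ψ := by
    refine ContDiff.sub (ContDiff.sub (ContDiff.sub (contDiff_sqrt_sq_add_sq hμp).neg ?_) ?_) ?_ <;>
    fun_prop
  have hside : ∀ y, |y| = L → ∀ s ∈ Icc 0 t₁, ψ (y, s) ≤ u (y, s) := by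
    intro y hy s hs
    have h1 := hlow y s hs
    have hy2 : y ^ 2 = L ^ 2 := by rw [← sq_abs, hy]
    have hy4 : y ^ 4 = L ^ 4 := by
      rw [show y ^ 4 = (y ^ 2) ^ 2 by ring, hy2]; ring
    simp only [hψ, hy4]
    rw [hy2] at h1
    have h2 : κ * L ^ 4 ≤ κ * (L ^ 4 * (1 + lam * s)) := by
      have : 0 ≤ lam * s := mul_nonneg (by positivity) hs.1
      gcongr
      exact le_mul_of_one_le_right (by positivity) (by linarith)
    have h3 : 0 ≤ μ * s := mul_nonneg hμp.le hs.1
    linarith [Real.sqrt_nonneg (μ ^ 2 + y ^ 2), hs.1]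
  have := hu.supersolution.le_of_firstOrder (a := -L) (b := L) (t₁ := t₁) le_rfl hu.continuousOn
    (ψ := ψ) hcd.continuous.continuousOn (fun y hy s hs => ?_)
    ?_ (hside (-L) (by rw [abs_neg, abs_of_pos hL0])) (hside L (abs_of_pos hL0))
    (x := x) (t := t) (abs_le.1 hLx) ⟨ht.le, by linarith⟩
  · have h1 : √(μ ^ 2 + x ^ 2) ≤ μ + |x| := by
      refine Real.sqrt_le_iff.2 ⟨by positivity, ?_⟩
      have := sq_abs x
      have := mul_nonneg hμp.le (abs_nonneg x)
      nlinarith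
    have h2 : κ * (x ^ 4 * (1 + lam * t)) ≤ κ * (2 * x ^ 4) := by
      have : lam * t ≤ 1 := by
        rw [← hlam']
        gcongr
        linarith
      rw [mul_comm 2]
      gcongr
      linarith
    have h3 : μ * (2 + t) = μ' := div_mul_cancel₀ _ (by positivity)
    simp only [hψ] at this
    linarith
  · obtain ⟨p, hp, hp1⟩ := hasDerivAt_sqrt_sq_add_sq hμp y
    refine ⟨hcd.contDiffAt, _, _, ?_, ?_, quartic_barrier_ineq (lt := lam * s) (y := y) hαp hκ hL0
      hlam (mul_nonneg (by positivity) hs.1.le) ?_ (abs_le.2 ⟨hy.1.le, hy.2.le⟩) hL1.le hp1⟩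
    · have := (((hasDerivAt_id s).div_const 2).const_sub (-√(μ ^ 2 + y ^ 2))).sub
        ((hasDerivAt_id s).const_mul μ) |>.sub
        (((((hasDerivAt_id s).const_mul lam).const_add 1).const_mul (y ^ 4)).const_mul κ)
      refine (this.congr_deriv ?_ :)
      ring
    · have := ((hp.neg.sub_const (s / 2)).sub_const (μ * s)).sub
        (((hasDerivAt_pow 4 y).mul_const (1 + lam * s)).const_mul κ)
      refine (this.congr_deriv ?_ :)
      norm_num
    · rw [← hlam']
      exact mul_le_mul_of_nonneg_left hs.2.le (by positivity)
  · intro y _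
    rw [hu.initial]
    have h1 : |y| ≤ √(μ ^ 2 + y ^ 2) := Real.abs_le_sqrt (by nlinarith)
    have h2 : 0 ≤ κ * y ^ 4 := by positivity
    simp only [hψ, mul_zero, zero_div, add_zero, mul_one, sub_zero]
    linarith

theorem IsViscositySolution.inviscid_eq
    (hu : IsViscositySolution (fun p => p ^ 2 / 2) 0 (fun x => -|x|) u) {x t : ℝ} (ht : 0 ≤ t) :
    u (x, t) = -|x| - t / 2 := by
  rcases ht.eq_or_lt with rfl | ht
  · simp [hu.initial]
  · exact le_antisymm (hu.inviscid_le ht.le) (hu.le_inviscid ht)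

end Inviscid

/-! ### The error estimate and its sharpness -/

/-- The upper factor 1 + δ is at most e^δ, and 2εδ = (2/√π) √(tε). -/
theorem abs_viscous_sub_inviscid_le {ε : ℝ} {v u : ℝ × ℝ → ℝ} (hε : 0 < ε)
    (hv : IsViscositySolution (fun p => p ^ 2 / 2) ε (fun x => -|x|) v)
    (hu : IsViscositySolution (fun p => p ^ 2 / 2) 0 (fun x => -|x|) u) {x t : ℝ} (ht : 0 ≤ t) :
    |v (x, t) - u (x, t)| ≤ 2 / √Real.pi * √(t * ε) := by
  have h1 := exp_le_viscousProfile (x := x) hε ht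
  have h2 := viscousProfile_le (x := x) hε ht
  rw [← hv.exp_eq_viscousProfile hε ht] at h1 h2
  set δ := 2 * (√t / (2 * √ε)) / √Real.pi with hδ
  have h3 := Real.exp_le_exp.1 h1
  have h4 : Real.exp (-v (x, t) / (2 * ε)) ≤ Real.exp ((|x| / 2 + t / 4) / ε + δ) := by
    rw [Real.exp_add]
    refine h2.trans (mul_le_mul_of_nonneg_left ?_ (Real.exp_pos _).le)
    linarith [Real.add_one_le_exp δ]
  have h5 := Real.exp_le_exp.1 h4
  have e1 : (|x| / 2 + t / 4) / ε = (|x| + t / 2) / (2 * ε) := by field_simp; ring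
  have e2 : δ = (2 / √Real.pi * √(t * ε)) / (2 * ε) := by
    have hs : 0 < √ε := Real.sqrt_pos.2 hε
    have hse : √ε ^ 2 = ε := Real.sq_sqrt hε.le
    have hpi : 0 < √Real.pi := Real.sqrt_pos.2 Real.pi_pos
    rw [hδ, Real.sqrt_mul ht]
    field_simp
    rw [hse]
  rw [e1] at h3 h5
  rw [e2, ← add_div] at h5
  have h6 := (div_le_div_iff_of_pos_right (by positivity)).1 h3
  have h7 := (div_le_div_iff_of_pos_right (by positivity)).1 h5
  rw [hu.inviscid_eq ht, abs_le]
  constructor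
  · linarith
  · have : 0 ≤ 2 / √Real.pi * √(t * ε) := by positivity
    linarith

/-- At x = 0 the profile is e^{t/(4ε)} · 2N(q), and √(tε) = 2εq. -/
theorem viscous_sub_inviscid_at_zero {ε : ℝ} {v u : ℝ × ℝ → ℝ} (hε : 0 < ε)
    (hv : IsViscositySolution (fun p => p ^ 2 / 2) ε (fun x => -|x|) v)
    (hu : IsViscositySolution (fun p => p ^ 2 / 2) 0 (fun x => -|x|) u) {t : ℝ} (ht : 0 < t) :
    (v (0, t) - u (0, t)) / √(t * ε)
      = -((√t / (2 * √ε))⁻¹ * Real.log (2 * gaussCDF (√t / (2 * √ε)))) := by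
  have h1 := hv.exp_eq_viscousProfile (x := 0) hε ht.le
  rw [viscousProfile_of_pos hε ht] at h1
  simp only [abs_zero, zero_div, mul_zero, zero_mul, neg_zero, Real.exp_zero, one_mul, zero_add,
    sub_zero] at h1
  set q := √t / (2 * √ε) with hq
  have hs : 0 < √ε := Real.sqrt_pos.2 hε
  have ht' : 0 < √t := Real.sqrt_pos.2 ht
  have hqp : 0 < q := by positivity
  have hN : 0 < gaussCDF q := by
    have := strictMono_gaussCDF hqp
    rw [gaussCDF_zero] at this
    linarith
  have h2 := congrArg Real.log h1
  rw [Real.log_exp, ← two_mul, Real.log_mul (Real.exp_pos _).ne' (by positivity), Real.log_exp] at h2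
  have h3 : v (0, t) = -t / 2 - 2 * ε * Real.log (2 * gaussCDF q) := by
    field_simp at h2
    linarith
  have hse : √ε ^ 2 = ε := Real.sq_sqrt hε.le
  have e : √(t * ε) = 2 * ε * q := by
    rw [Real.sqrt_mul ht.le, hq]
    field_simp
    rw [hse]
  rw [hu.inviscid_eq ht.le, h3, e, abs_zero]
  field_simp
  ring

/-- This is the derivative of log(2N) at 0, where 2N = 1. -/
theorem tendsto_inv_mul_log_gaussCDF :
    Tendsto (fun q : ℝ => q⁻¹ * Real.log (2 * gaussCDF q)) (𝓝[≠] 0) (𝓝 (2 / √Real.pi)) := by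
  have h1 := ((hasDerivAt_gaussCDF 0).const_mul 2).log (by rw [gaussCDF_zero]; norm_num)
  have h2 := hasDerivAt_iff_tendsto_slope_zero.1 h1
  simpa [gaussCDF_zero, div_eq_mul_inv] using h2

theorem proposition4p3 :
    (∃ C : ℝ, 0 < C ∧ ∀ ε : ℝ, 0 < ε → ε < 1 → ∀ T : ℝ, 0 < T →
      ∀ uε u : ℝ × ℝ → ℝ,
        IsViscositySolution (fun p => p ^ 2 / 2) ε (fun x => -|x|) uε →
        IsViscositySolution (fun p => p ^ 2 / 2) 0 (fun x => -|x|) u →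
          eLpNorm (fun z => uε z - u z) ⊤
              ((volume : Measure (ℝ × ℝ)).restrict (univ ×ˢ Icc 0 T))
            ≤ ENNReal.ofReal (C * Real.sqrt (T * ε))) ∧
    (∀ ε : ℝ, 0 < ε → ∀ uε u : ℝ × ℝ → ℝ,
        IsViscositySolution (fun p => p ^ 2 / 2) ε (fun x => -|x|) uε →
        IsViscositySolution (fun p => p ^ 2 / 2) 0 (fun x => -|x|) u →
          Tendsto (fun t : ℝ => (uε (0, t) - u (0, t)) / Real.sqrt (t * ε))
            (𝓝[>] 0) (𝓝 (-(2 / Real.sqrt Real.pi)))) := by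

  refine ⟨⟨2 / √Real.pi, by positivity, fun ε hε _ T hT v u hv hu => ?_⟩, fun ε hε v u hv hu => ?_⟩
  · rw [eLpNorm_exponent_top]
    refine eLpNormEssSup_le_of_ae_bound ?_
    have hm : MeasurableSet ((univ : Set ℝ) ×ˢ Icc 0 T) := MeasurableSet.univ.prod measurableSet_Icc
    filter_upwards [ae_restrict_mem hm] with z hz
    rw [Real.norm_eq_abs]
    refine (abs_viscous_sub_inviscid_le (x := z.1) (t := z.2) hε hv hu hz.2.1).trans ?_
    have := hz.2.2
    gcongr
  · have hq : Tendsto (fun t : ℝ => √t / (2 * √ε)) (𝓝[>] 0) (𝓝[≠] 0) := by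
      refine tendsto_nhdsWithin_iff.2 ⟨?_, ?_⟩
      · have : Continuous fun t : ℝ => √t / (2 * √ε) := by fun_prop
        simpa using (this.tendsto 0).mono_left nhdsWithin_le_nhds
      · filter_upwards [self_mem_nhdsWithin] with t ht
        have h1 : 0 < √t := Real.sqrt_pos.2 ht
        have h2 : 0 < √ε := Real.sqrt_pos.2 hε
        exact (div_pos h1 (by positivity)).ne'
    refine ((tendsto_inv_mul_log_gaussCDF.comp hq).neg).congr' ?_
    filter_upwards [self_mem_nhdsWithin] with t ht
    exact (viscous_sub_inviscid_at_zero hε hv hu ht).symm
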